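/- **Theorem (Classical limit of the phase transition states).** Let $\nu\ge 3$ and $\beta>0$. Equip the Schwartz space $E=\mathcal S(\mathbb R^\nu)$ with the $L^2$ inner product $\langle\cdot,\cdot\rangle$ (antilinear in the first argument) and put $\sigma=\operatorname{Im}\langle\cdot,\cdot\rangle$. For $h\ge 0$ let $\Delta(E,h\sigma)$ be the $*$-algebra with basis $\{W^h(f)\}_{f\in E}$ and relations $$W^h(f)W^h(g)=e^{-\frac i2 h\sigma(f,g)}W^h(f+g),\qquad W^h(f)^*=W^h(-f),\qquad W^h(0)=1,$$ and let $\mathcal W(E,h\sigma)$ be its completion in the norm $\|a\|=\sup_\omega\omega(a^*a)^{1/2}$, the supremum running over all states $\omega$ of $\Delta(E,h\sigma)$. Let $Q_h:\mathcal W(E,0)\to\mathcal W(E,h\sigma)$ be the continuous linear map with $Q_h(W^0(f))=e^{-\frac h4\|f\|^2}W^h(f)$. Let $H=-\Delta/2$ on $E$ and $\tau^0_{h,t}(W^h(f))=W^h(e^{itH}f)$. With $\hat f(p)=\int e^{-ip\cdot x}f(x)\,d^\nu x$, functions of $H$ are understood through $\langle f,\varphi(H)f\rangle=\int\frac{d^\nu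 p}{(2\pi)^\nu}\,\varphi(p^2/2)\,|\hat f(p)|^2$, and the critical density is $$\rho_c(b)=\int_{\mathbb R^\nu}\frac{d^\nu p}{(2\pi)^\nu}\,\frac{e^{-bp^2/2}}{1-e^{-bp^2/2}}.$$ *Classical KMS condition.* Let $E'$ be the topological dual of the normed space $E$ with the weak-$*$ topology; let $\Phi_0(f)$ be evaluation at $f$, a continuous function on $E'$, and identify $W^0(f)$ with the function $e^{i\Phi_0(f)}$. On $\Delta(E,0)$ put $\{W^0(f),W^0(g)\}=\sigma(g,f)W^0(f+g)$. A *weak derivation* is a linear map $\delta$ from a $*$-subalgebra $D(\delta)\subset\Delta(E,0)$ to the continuous functions on $E'$ with $\delta(a^*)=\overline{\delta(a)}$, $\delta(ab)=\delta(a)b+a\delta(b)$, such that $E(\delta)=\{f: W^0(f)\in D(\delta)\}$ is a dense subspace of $E$. It is *continuous* if $\mathbb C\ni\lambda\mapsto\delta(W^0(\lambda f))$ is pointwise continuous for each $f\in E(\delta)$; *linear* if $W^0(-f)\delta(W^0(f))$ is an $\mathbb R$-linear functional on $E'$ for each $f\in E(\delta)$; *pointwise closed* if, whenever $f_n\in E(\delta)$,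 $f_n\to f\in E$ weakly and $\delta(W^0(f_n))\to\Psi$ pointwise with $\Psi$ continuous, then $f\in E(\delta)$ and $\delta(W^0(f))=\Psi$. A state $\omega$ of $\mathcal W(E,0)$ is $C^2$ if its GNS representation $(\pi,\Omega)$ is regular (each $t\mapsto\pi(W^0(tf))$ is strongly continuous) and $\Omega$ lies in the domain of the generator of $t\mapsto\pi(W^0(tf))$ for every $f\in E$; then $\omega(\Phi_0(f)W^0(g))=-i\frac{d}{dt}\omega(W^0(g+tf))|_{t=0}$, extended linearly. A state $\omega$ is a $(\delta,\beta)$-*weak KMS state* if $\delta$ is a continuous, linear, pointwise closed weak derivation, $\omega$ is $C^2$, and $\omega(\{a,b\})=\beta\,\omega(b\,\delta(a))$ for all $a,b\in D(\delta)$. Let $\delta^0_0$ be the weak derivation with domain $\Delta(E,0)$ and $\delta_0^0(W^0(f))=i\Phi_0(iHf)W^0(f)$. *Statement.* For every $\alpha\in[0,\infty)$ there is a state $\omega_0^{\alpha,0}$ of $\mathcal W(E,0)$ with $$\omega_0^{\alpha,0}(W^0(f))=\exp\Big(-\tfrac12\Big(\langle f,(\beta H)^{-1}f\rangle+2^\nu\alpha\Big|\int_{\mathbb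 R^\nu}f(x)\,d^\nu x\Big|^2\Big)\Big),\qquad f\in E;$$ different values of $\alpha$ give different states, and each $\omega_0^{\alpha,0}$ is a $(\delta_0^0,\beta)$-weak KMS state. Moreover, let $\bar\rho:(0,\infty)\to\mathbb R$ satisfy $\bar\rho(h)>\rho_c(\beta h)$ for all $h>0$ and $h(\bar\rho(h)-\rho_c(\beta h))\to\alpha\in[0,\infty)$ as $h\to0^+$. Then for every $h>0$ there is a state $\omega_h^{\bar\rho(h),0}$ of $\mathcal W(E,h\sigma)$ (the Araki–Woods condensate state) with $$\omega_h^{\bar\rho(h),0}(W^h(f))=\exp\Big(-\tfrac h4\Big(\langle f,(1+e^{-\beta hH})(1-e^{-\beta hH})^{-1}f\rangle+2^{\nu+1}(\bar\rho(h)-\rho_c(\beta h))\Big|\int_{\mathbb R^\nu} f(x)\,d^\nu x\Big|^2\Big)\Big),\qquad f\in E;$$ it satisfies the $(\tau^0_h,\beta h)$-KMS condition (for all $A,B$ there is a bounded continuous function $F$ on the strip $0\le\operatorname{Im}z\le\beta h$, holomorphic in its interior, with $F(t)=\omega(A\tau_t(B))$ and $F(t+i\beta h)=\omega(\tau_t(B)A)$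 for $t\in\mathbb R$), and $$\lim_{h\to0^+}\omega_h^{\bar\rho(h),0}(Q_h(c))=\omega_0^{\alpha,0}(c)\qquad\text{for all }c\in\mathcal W(\mathcal S(\mathbb R^\nu),0).$$ -/

import Mathlib

open scoped NNReal ComplexOrder InnerProductSpace ComplexConjugate

set_option linter.unusedSectionVars false

noncomputable section

namespace FreeBose

variable {E : Type*} [NormedAddCommGroup E] [InnerProductSpace ℂ E]

/-- The symplectic form `σ(f, g) = Im ⟨f, g⟩`. -/
def symp (f g : E) : ℝ := (inner ℂ f g).im

lemma symp_self (f : E) : symp f f = 0 := inner_self_im (𝕜 := ℂ) f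
lemma symp_neg_left (f g : E) : symp (-f) g = -symp f g := by simp [symp]
lemma symp_neg_right (f g : E) : symp f (-g) = -symp f g := by simp [symp]
lemma symp_add_left (f g k : E) : symp (f + g) k = symp f k + symp g k := by
  simp [symp]
lemma symp_add_right (f g k : E) : symp f (g + k) = symp f g + symp f k := by
  simp [symp]
lemma symp_swap (f g : E) : symp g f = -symp f g := by
  rw [symp, symp, ← inner_conj_symm g f, Complex.conj_im]

/-- The cocycle `exp (-(i/2) h σ(f, g))`. -/
def phase (h : ℝ≥0) (f g : E) : ℂ := Complex.exp (-(Complex.I / 2 * (h * symp f g : ℝ)))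

lemma phase_zero_left (h : ℝ≥0) (f : E) : phase h 0 f = 1 := by simp [phase, symp]
lemma phase_zero_right (h : ℝ≥0) (f : E) : phase h f 0 = 1 := by simp [phase, symp]
lemma phase_zero (f g : E) : phase 0 f g = 1 := by simp [phase]
lemma phase_neg_self (h : ℝ≥0) (f : E) : phase h (-f) f = 1 := by
  simp [phase, symp_neg_left, symp_self]
lemma phase_cocycle (h : ℝ≥0) (f g k : E) :
    phase h f g * phase h (f + g) k = phase h g k * phase h f (g + k) := by
  simp only [phase, ← Complex.exp_add, symp_add_left, symp_add_right]
  congr 1; push_cast; ring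
lemma phase_conj (h : ℝ≥0) (f g : E) : conj (phase h f g) = phase h (-g) (-f) := by
  rw [phase, phase, ← Complex.exp_conj, symp_neg_left, symp_neg_right, symp_swap f g]
  congr 1; simp [map_ofNat]; ring

variable (E) in
/-- The `*`-algebra `Δ(E, hσ)`, realised on the finitely supported functions on `E`. -/
def WeylPre (_h : ℝ≥0) : Type _ := E →₀ ℂ

namespace WeylPre

variable {h : ℝ≥0}

instance : AddCommGroup (WeylPre E h) := inferInstanceAs (AddCommGroup (E →₀ ℂ))
instance : Module ℂ (WeylPre E h) := inferInstanceAs (Module ℂ (E →₀ ℂ))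

variable (h) in
/-- The Weyl element `W^h(f)` of `Δ(E, hσ)`. -/
def W (f : E) : WeylPre E h := Finsupp.single f 1

variable (h) in
/-- The Weyl elements form a basis of `Δ(E, hσ)`. -/
def basis : Module.Basis E ℂ (WeylPre E h) := ⟨LinearEquiv.refl ℂ (E →₀ ℂ)⟩

@[simp] lemma basis_apply (f : E) : basis h f = W h f := rfl

@[elab_as_elim]
lemma induction {p : WeylPre E h → Prop} (zero : p 0) (add : ∀ a b, p a → p b → p (a + b))
    (W : ∀ (c : ℂ) f, p (c • W h f)) (a : WeylPre E h) : p a := by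
  induction a using Finsupp.induction_linear with
  | zero => exact zero
  | add a b ha hb => exact add a b ha hb
  | single f c =>
    have := W c f
    rw [WeylPre.W] at this
    have e : (Finsupp.single f c : E →₀ ℂ) = c • Finsupp.single f 1 :=
      (Finsupp.smul_single_one f c).symm
    exact e ▸ this

/-- The bilinear product with `W^h(f) W^h(g) = exp (-(i/2) h σ(f, g)) W^h(f + g)`. -/
def mulL : WeylPre E h →ₗ[ℂ] WeylPre E h →ₗ[ℂ] WeylPre E h :=
  (basis h).constr ℂ fun f => (basis h).constr ℂ fun g => phase h f g • W h (f + g)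

instance : Mul (WeylPre E h) := ⟨fun a b => mulL a b⟩
instance : One (WeylPre E h) := ⟨W h 0⟩

lemma mul_def (a b : WeylPre E h) : a * b = mulL a b := rfl
lemma one_def : (1 : WeylPre E h) = W h 0 := rfl

lemma W_mul_W (f g : E) : W h f * W h g = phase h f g • W h (f + g) := by
  rw [mul_def, mulL, ← basis_apply, ← basis_apply, Module.Basis.constr_basis,
    Module.Basis.constr_basis]

instance : NonUnitalNonAssocRing (WeylPre E h) where
  left_distrib a b c := by simp [mul_def]
  right_distrib a b c := by simp [mul_def]
  zero_mul a := by simp [mul_def]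
  mul_zero a := by simp [mul_def]

instance : IsScalarTower ℂ (WeylPre E h) (WeylPre E h) := ⟨fun c a b => by
  simp [mul_def, smul_eq_mul]⟩
instance : SMulCommClass ℂ (WeylPre E h) (WeylPre E h) := ⟨fun c a b => by
  simp [mul_def, smul_eq_mul]⟩

instance : Ring (WeylPre E h) where
  mul_assoc a b c := by
    induction a using induction with
    | zero => simp
    | add x y hx hy => simp only [add_mul, hx, hy]
    | W x f =>
      induction b using induction with
      | zero => simp
      | add x y hx hy => simp only [add_mul, mul_add, hx, hy]
      | W y g =>
        induction c using induction with
        | zero => simp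
        | add x y hx hy => simp only [mul_add, hx, hy]
        | W z k =>
          simp only [smul_mul_assoc, mul_smul_comm, W_mul_W, smul_smul, add_assoc]
          congr 1
          linear_combination (x * y * z) * phase_cocycle h f g k
  one_mul a := by
    induction a using induction with
    | zero => simp
    | add x y hx hy => simp only [mul_add, hx, hy]
    | W x f => rw [one_def, mul_smul_comm, W_mul_W, phase_zero_left, one_smul, zero_add]
  mul_one a := by
    induction a using induction with
    | zero => simp
    | add x y hx hy => simp only [add_mul, hx, hy]
    | W x f => rw [one_def, smul_mul_assoc, W_mul_W, phase_zero_right, one_smul, add_zero]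
  neg_add_cancel a := neg_add_cancel a
  zsmul := fun n a => n • a
  zsmul_zero' := zero_zsmul
  zsmul_succ' := SubNegMonoid.zsmul_succ'
  zsmul_neg' := SubNegMonoid.zsmul_neg'
  sub_eq_add_neg := sub_eq_add_neg

instance : Algebra ℂ (WeylPre E h) := Algebra.ofModule smul_mul_assoc mul_smul_comm

/-- The conjugate-linear map sending the delta function at `f` to the one at `-f`. -/
def starFinsupp : (E →₀ ℂ) →ₗ⋆[ℂ] (E →₀ ℂ) where
  toFun a := Finsupp.mapDomain Neg.neg (Finsupp.mapRange conj (map_zero _) a)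
  map_add' a b := by rw [Finsupp.mapRange_add (map_add _), Finsupp.mapDomain_add]
  map_smul' c a := by
    rw [← Finsupp.mapDomain_smul]; congr 1
    ext f; exact map_mul conj c (a f)

/-- The conjugate-linear map with `W^h(f) ↦ W^h(-f)`. -/
def starL : WeylPre E h →ₗ⋆[ℂ] WeylPre E h := starFinsupp

lemma starL_W (f : E) : starL (W h f) = W h (-f) := by
  change starFinsupp (Finsupp.single f 1) = Finsupp.single (-f) 1
  simp [starFinsupp]

instance : StarAddMonoid (WeylPre E h) where
  star a := starL a
  star_involutive a := by
    change starL (starL a) = a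
    induction a using induction with
    | zero => simp
    | add x y hx hy => simp only [map_add, hx, hy]
    | W x f => simp [starL_W, map_smulₛₗ]
  star_add a b := map_add starL a b

lemma star_def (a : WeylPre E h) : star a = starL a := rfl

lemma star_W (f : E) : star (W h f) = W h (-f) := starL_W f

instance : StarModule ℂ (WeylPre E h) := ⟨fun c a => map_smulₛₗ starL c a⟩

instance : StarRing (WeylPre E h) where
  star_add a b := map_add starL a b
  star_mul a b := by
    induction a using induction with
    | zero => simp
    | add x y hx hy => simp only [add_mul, mul_add, star_add, hx, hy]
    | W x f =>
      induction b using induction with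
      | zero => simp
      | add x y hx hy => simp only [add_mul, mul_add, star_add, hx, hy]
      | W y g =>
        simp only [smul_mul_assoc, mul_smul_comm, W_mul_W, smul_smul, star_smul, star_W,
          ← phase_conj]
        rw [add_comm f g, neg_add]
        congr 1
        simp only [← starRingEnd_apply, map_mul]; ring


lemma star_W_mul_W (f g : E) :
    star (W h f) * W h g = phase h (-f) g • W h (g - f) := by
  rw [star_W, W_mul_W, neg_add_eq_sub]

lemma star_W_mul_self (f : E) : star (W h f) * W h f = 1 := by
  rw [star_W_mul_W, phase_neg_self, one_smul, sub_self, one_def]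

lemma repr_W (f : E) : (basis h).repr (W h f) = Finsupp.single f 1 := rfl

lemma repr_star_mul_zero (a b : WeylPre E h) : (basis h).repr (star a * b) 0 =
    ((basis h).repr b).sum fun f y => conj ((basis h).repr a f) * y := by
  induction b using induction with
  | zero => simp
  | add x y hx hy =>
    rw [mul_add, map_add, map_add, Finsupp.add_apply, hx, hy, Finsupp.sum_add_index']
    · simp
    · intro _ _ _; ring
  | W y g =>
    rw [map_smul, repr_W, Finsupp.smul_single_one, Finsupp.sum_single_index (by simp)]
    induction a using induction with
    | zero => simp
    | add x z hx hz => simp only [star_add, add_mul, map_add, Finsupp.add_apply, hx, hz]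
    | W x f =>
      simp only [star_smul, smul_mul_assoc, mul_smul_comm, star_W_mul_W, map_smul, repr_W,
        Finsupp.smul_apply, smul_eq_mul, map_mul]
      by_cases hfg : f = g
      · subst hfg
        simp [phase_neg_self, mul_comm]
      · rw [Finsupp.single_eq_of_ne (by simpa [eq_comm, sub_eq_zero] using hfg),
          Finsupp.single_eq_of_ne (by simpa [eq_comm] using hfg)]
        simp

end WeylPre

variable (E) in
/-- The states of the `*`-algebra `Δ(E, hσ)`. -/
structure PreState (h : ℝ≥0) where
  /-- the underlying linear functional -/
  toLin : WeylPre E h →ₗ[ℂ] ℂ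
  nonneg : ∀ a, 0 ≤ toLin (star a * a)
  map_one : toLin 1 = 1

namespace PreState

open WeylPre

variable {h : ℝ≥0} (ω : PreState E h)

lemma re_nonneg (a : WeylPre E h) : 0 ≤ (ω.toLin (star a * a)).re :=
  (Complex.nonneg_iff.mp (ω.nonneg a)).1

lemma im_eq (a : WeylPre E h) : (ω.toLin (star a * a)).im = 0 :=
  (Complex.nonneg_iff.mp (ω.nonneg a)).2.symm

lemma conj_symm (a b : WeylPre E h) :
    conj (ω.toLin (star b * a)) = ω.toLin (star a * b) := by
  have e1 := ω.im_eq (a + b)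
  have e2 := ω.im_eq (a + Complex.I • b)
  simp only [star_add, star_smul, add_mul, mul_add, map_add, smul_mul_assoc, mul_smul_comm,
    map_smul, Complex.add_im, ω.im_eq, smul_eq_mul, Complex.star_def, Complex.conj_I] at e1 e2
  have h3 := ω.im_eq b
  simp [ω.im_eq] at e1 e2
  apply Complex.ext
  · simp; linarith
  · simp; linarith

/-- The semi-inner product `⟨a, b⟩ = ω(a* b)`. -/
abbrev core : PreInnerProductSpace.Core ℂ (WeylPre E h) where
  inner a b := ω.toLin (star a * b)
  conj_inner_symm a b := ω.conj_symm a b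
  re_inner_nonneg a := ω.re_nonneg a
  add_left a b c := by simp [add_mul]
  smul_left a b c := by simp

/-- The seminorm `a ↦ ω(a* a)^{1/2}`. -/
def sn (a : WeylPre E h) : ℝ := √(ω.toLin (star a * a)).re

lemma sn_nonneg (a : WeylPre E h) : 0 ≤ ω.sn a := Real.sqrt_nonneg _

lemma sn_sq (a : WeylPre E h) : ω.sn a ^ 2 = (ω.toLin (star a * a)).re :=
  Real.sq_sqrt (ω.re_nonneg a)

lemma sn_add (a b : WeylPre E h) : ω.sn (a + b) ≤ ω.sn a + ω.sn b := by
  let c := InnerProductSpace.Core.toSeminormedAddCommGroup (c := ω.core)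
  exact norm_add_le a b

lemma cauchy_schwarz (a b : WeylPre E h) : ‖ω.toLin (star a * b)‖ ≤ ω.sn a * ω.sn b := by
  let c := InnerProductSpace.Core.toSeminormedAddCommGroup (c := ω.core)
  let := InnerProductSpace.ofCore ω.core
  exact norm_inner_le_norm (𝕜 := ℂ) a b

lemma sn_smul (z : ℂ) (a : WeylPre E h) : ω.sn (z • a) = ‖z‖ * ω.sn a := by
  have : ω.toLin (star (z • a) * (z • a)) = (‖z‖ ^ 2 : ℝ) * ω.toLin (star a * a) := by
    rw [star_smul, smul_mul_assoc, mul_smul_comm, smul_smul, map_smul, smul_eq_mul,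
      Complex.star_def, Complex.conj_mul']; push_cast; rfl
  rw [sn, sn, this, Complex.re_ofReal_mul, Real.sqrt_mul (by positivity),
    Real.sqrt_sq (norm_nonneg z)]

lemma sn_W (f : E) : ω.sn (W h f) = 1 := by
  rw [sn, star_W_mul_self, ω.map_one]; simp

lemma sn_one : ω.sn 1 = 1 := ω.sn_W 0

lemma sn_bdd (a : WeylPre E h) : ∃ C, ∀ ω : PreState E h, ω.sn a ≤ C := by
  induction a using WeylPre.induction with
  | zero => exact ⟨0, fun ω => by simp [sn]⟩
  | add a b ha hb =>
    obtain ⟨C, hC⟩ := ha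
    obtain ⟨D, hD⟩ := hb
    exact ⟨C + D, fun ω => (ω.sn_add a b).trans (add_le_add (hC ω) (hD ω))⟩
  | W z f => exact ⟨‖z‖, fun ω => by rw [sn_smul, sn_W, mul_one]⟩

/-- The state `a ↦ ω(b* a b) / ω(b* b)`. -/
def conjBy (b : WeylPre E h) (hb : ω.sn b ≠ 0) : PreState E h where
  toLin := ((ω.sn b ^ 2)⁻¹ : ℂ) •
    (ω.toLin ∘ₗ LinearMap.mulLeft ℂ (star b) ∘ₗ LinearMap.mulRight ℂ b)
  nonneg a := by
    have e : star b * (star a * a * b) = star (a * b) * (a * b) := by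
      rw [star_mul]; noncomm_ring
    have := ω.nonneg (a * b)
    simp only [LinearMap.smul_apply, LinearMap.comp_apply, LinearMap.mulLeft_apply,
      LinearMap.mulRight_apply, e, smul_eq_mul]
    refine mul_nonneg ?_ this
    rw [← Complex.ofReal_pow, ← Complex.ofReal_inv]
    exact_mod_cast inv_nonneg.mpr (sq_nonneg _)
  map_one := by
    simp only [LinearMap.smul_apply, LinearMap.comp_apply, LinearMap.mulLeft_apply,
      LinearMap.mulRight_apply, one_mul, smul_eq_mul]
    have : ω.toLin (star b * b) = ((ω.sn b ^ 2 : ℝ) : ℂ) := by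
      rw [ω.sn_sq]
      exact Complex.ext rfl (by simp [ω.im_eq])
    rw [this]; push_cast
    exact inv_mul_cancel₀ (pow_ne_zero 2 (by exact_mod_cast hb))

lemma sn_mul (a b : WeylPre E h) (hb : ω.sn b ≠ 0) :
    ω.sn (a * b) = (ω.conjBy b hb).sn a * ω.sn b := by
  have e : star b * (star a * a * b) = star (a * b) * (a * b) := by
    rw [star_mul]; noncomm_ring
  rw [← sq_eq_sq₀ (ω.sn_nonneg _) (mul_nonneg ((ω.conjBy b hb).sn_nonneg _) (ω.sn_nonneg _)),
    mul_pow, sn_sq, sn_sq]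
  simp only [conjBy, LinearMap.smul_apply, LinearMap.comp_apply, LinearMap.mulLeft_apply,
      LinearMap.mulRight_apply, e, smul_eq_mul]
  rw [← Complex.ofReal_pow, ← Complex.ofReal_inv, Complex.re_ofReal_mul]
  field_simp

lemma sn_mul_eq_zero (a b : WeylPre E h) (hb : ω.sn b = 0) : ω.sn (a * b) = 0 := by
  have e : star b * (star a * a * b) = star (a * b) * (a * b) := by
    rw [star_mul]; noncomm_ring
  have := ω.cauchy_schwarz b (star a * a * b)
  rw [hb, zero_mul, e] at this
  have h0 : ω.toLin (star (a * b) * (a * b)) = 0 := by simpa using this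
  rw [sn, h0]; simp

/-- The canonical central (tracial) state `W^h(f) ↦ δ_{f,0}`. -/
def trace : PreState E h where
  toLin := (basis h).coord 0
  nonneg a := by
    rw [Module.Basis.coord_apply, repr_star_mul_zero]
    refine Finset.sum_nonneg fun f _ => ?_
    beta_reduce
    rw [mul_comm, Complex.mul_conj]
    exact_mod_cast Complex.normSq_nonneg _
  map_one := by rw [one_def, Module.Basis.coord_apply, repr_W]; simp

lemma trace_sn_eq_zero {a : WeylPre E h} (ha : (trace (E := E) (h := h)).sn a = 0) : a = 0 := by
  have h1 : (trace (E := E) (h := h)).toLin (star a * a) = 0 := by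
    have := (trace (E := E) (h := h)).sn_sq a
    rw [ha] at this
    exact Complex.ext (by simpa using this.symm) (trace.im_eq a)
  change (basis h).repr (star a * a) 0 = 0 at h1
  rw [repr_star_mul_zero, Finsupp.sum, Finset.sum_eq_zero_iff_of_nonneg] at h1
  · apply (basis h).repr.injective
    rw [map_zero]
    ext f
    by_contra hf
    have := h1 f (Finsupp.mem_support_iff.mpr hf)
    exact hf (by simpa using this)
  · intro f _
    rw [mul_comm, Complex.mul_conj]
    exact_mod_cast Complex.normSq_nonneg _

instance : Nonempty (PreState E h) := ⟨trace⟩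

end PreState

namespace WeylPre

variable {h : ℝ≥0}

/-- The `C*`-norm `‖a‖_h = sup {ω(a* a)^{1/2} : ω a state of Δ(E, hσ)}`. -/
instance : Norm (WeylPre E h) := ⟨fun a => ⨆ ω : PreState E h, ω.sn a⟩

lemma norm_def (a : WeylPre E h) : ‖a‖ = ⨆ ω : PreState E h, ω.sn a := rfl

lemma sn_le_norm (ω : PreState E h) (a : WeylPre E h) : ω.sn a ≤ ‖a‖ := by
  obtain ⟨C, hC⟩ := PreState.sn_bdd a
  exact le_ciSup (f := fun ω : PreState E h => ω.sn a) ⟨C, by rintro _ ⟨ω, rfl⟩; exact hC ω⟩ ω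

lemma norm_le_of {a : WeylPre E h} {C : ℝ} (hC : ∀ ω : PreState E h, ω.sn a ≤ C) : ‖a‖ ≤ C :=
  ciSup_le hC

lemma norm_nonneg' (a : WeylPre E h) : 0 ≤ ‖a‖ :=
  (PreState.trace.sn_nonneg a).trans (sn_le_norm _ a)

lemma norm_smul' (z : ℂ) (a : WeylPre E h) : ‖z • a‖ = ‖z‖ * ‖a‖ := by
  simp only [norm_def, PreState.sn_smul]
  exact (Real.mul_iSup_of_nonneg (norm_nonneg z) _).symm

lemma norm_mul_le' (a b : WeylPre E h) : ‖a * b‖ ≤ ‖a‖ * ‖b‖ := by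
  refine norm_le_of fun ω => ?_
  by_cases hb : ω.sn b = 0
  · rw [ω.sn_mul_eq_zero a b hb]
    exact mul_nonneg (norm_nonneg' _) (norm_nonneg' _)
  · rw [ω.sn_mul a b hb]
    exact mul_le_mul (sn_le_norm _ _) (sn_le_norm _ _) (ω.sn_nonneg _) (norm_nonneg' _)

lemma norm_mul_self_le (a : WeylPre E h) : ‖a‖ * ‖a‖ ≤ ‖star a * a‖ := by
  rw [← pow_two]
  refine (Real.le_sqrt (norm_nonneg' _) (norm_nonneg' _)).mp ?_
  refine norm_le_of fun ω => Real.le_sqrt_of_sq_le ?_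
  rw [ω.sn_sq]
  have := ω.cauchy_schwarz 1 (star a * a)
  rw [star_one, one_mul, ω.sn_one, one_mul] at this
  exact (Complex.re_le_norm _).trans (this.trans (sn_le_norm _ _))

lemma norm_le_norm_star (a : WeylPre E h) : ‖a‖ ≤ ‖star a‖ := by
  rcases (norm_nonneg' a).eq_or_lt with h0 | h0
  · rw [← h0]; exact norm_nonneg' _
  · exact le_of_mul_le_mul_right ((norm_mul_self_le a).trans (norm_mul_le' _ _)) h0

instance : NormedAddCommGroup (WeylPre E h) :=
  AddGroupNorm.toNormedAddCommGroup
    { toFun := fun a => ‖a‖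
      map_zero' := by simpa using norm_smul' (0 : ℂ) (0 : WeylPre E h)
      add_le' := fun a b => norm_le_of fun ω =>
        (ω.sn_add a b).trans (add_le_add (sn_le_norm _ _) (sn_le_norm _ _))
      neg' := fun a => by simpa using norm_smul' (-1 : ℂ) a
      eq_zero_of_map_eq_zero' := fun a ha => PreState.trace_sn_eq_zero
        (le_antisymm ((sn_le_norm _ a).trans_eq ha) (PreState.trace.sn_nonneg a)) }

instance : NormedRing (WeylPre E h) where
  __ := (inferInstance : NormedAddCommGroup (WeylPre E h))
  __ := (inferInstance : Ring (WeylPre E h))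
  norm_mul_le := norm_mul_le'

instance : NormedAlgebra ℂ (WeylPre E h) where
  norm_smul_le z a := (norm_smul' z a).le

instance : CStarRing (WeylPre E h) := ⟨fun _ => norm_mul_self_le _⟩

end WeylPre

section Completion

open UniformSpace Completion

variable {A : Type*} [NormedRing A] [NormedAlgebra ℂ A] [StarRing A] [CStarRing A] [StarModule ℂ A]

instance : Star (Completion A) := ⟨Completion.map star⟩

lemma star_isometry : Isometry (star : A → A) :=
  AddMonoidHomClass.isometry_of_norm (starAddEquiv : A ≃+ A) (norm_star)

lemma coe_star (a : A) : ((star a : A) : Completion A) = star (a : Completion A) :=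
  (Completion.map_coe star_isometry.uniformContinuous a).symm

lemma continuous_star' : Continuous (star : Completion A → Completion A) :=
  Completion.continuous_map

instance : StarRing (Completion A) where
  star_involutive a := by
    induction a using induction_on with
    | hp => exact isClosed_eq (continuous_star'.comp continuous_star') continuous_id
    | ih a => rw [← coe_star, ← coe_star, star_star]
  star_mul a b := by
    induction a, b using induction_on₂ with
    | hp =>
      exact isClosed_eq (continuous_star'.comp continuous_mul)
        ((continuous_star'.comp continuous_snd).mul (continuous_star'.comp continuous_fst))
    | ih a b => rw [← coe_mul, ← coe_star, ← coe_star, ← coe_star, star_mul, coe_mul]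
  star_add a b := by
    induction a, b using induction_on₂ with
    | hp =>
      exact isClosed_eq (continuous_star'.comp continuous_add)
        ((continuous_star'.comp continuous_fst).add (continuous_star'.comp continuous_snd))
    | ih a b => rw [← coe_add, ← coe_star, ← coe_star, ← coe_star, star_add, coe_add]

instance : Algebra ℂ (Completion A) := Completion.algebra A ℂ

/-- The completion of a `*`-algebra with respect to a `C*`-norm is a `C*`-algebra. -/
instance : CStarAlgebra (Completion A) where
  norm_mul_self_le a := by
    induction a using induction_on with
    | hp =>
      exact isClosed_le (by fun_prop)
        (continuous_norm.comp (continuous_star'.mul continuous_id))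
    | ih a =>
      rw [← coe_star, ← coe_mul, norm_coe, norm_coe]
      exact CStarRing.norm_mul_self_le a
  star_smul z a := by
    induction a using induction_on with
    | hp =>
      exact isClosed_eq (continuous_star'.comp (continuous_const_smul z))
        ((continuous_const_smul (star z)).comp continuous_star')
    | ih a => rw [← coe_smul, ← coe_star, ← coe_star, star_smul, coe_smul]
  norm_smul_le := norm_smul_le

end Completion

section Algebra

open UniformSpace Completion

variable (E) in
/-- The Weyl `C*`-algebra `W(E, hσ)`: the completion of `Δ(E, hσ)`. -/
abbrev WeylAlg (h : ℝ≥0) : Type _ := Completion (WeylPre E h)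

instance (h : ℝ≥0) : PartialOrder (WeylAlg E h) := CStarAlgebra.spectralOrder _
instance (h : ℝ≥0) : StarOrderedRing (WeylAlg E h) := CStarAlgebra.spectralOrderedRing _

/-- The Weyl element `W^h(f)` of `W(E, hσ)`. -/
def weyl (h : ℝ≥0) (f : E) : WeylAlg E h := (WeylPre.W h f : WeylPre E h)

variable (E) in
/-- The states of `W(E, hσ)`: positive normalized linear functionals. -/
structure WeylState (h : ℝ≥0) where
  /-- the underlying positive linear functional -/
  toPLM : WeylAlg E h →ₚ[ℂ] ℂ
  map_one : toPLM 1 = 1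

instance (h : ℝ≥0) : CoeFun (WeylState E h) (fun _ => WeylAlg E h → ℂ) := ⟨fun ω => ω.toPLM⟩

/-! ### The quantization map -/

open WeylPre

variable {h : ℝ≥0}

lemma PosSemidef.sum_nonneg {M : Matrix E E ℂ} (hM : M.PosSemidef) (s : Finset E) (y : E → ℂ) :
    0 ≤ ∑ f ∈ s, ∑ g ∈ s, star (y f) * M f g * y g := by
  classical
  have h1 := hM.2 (Finsupp.indicator s fun f _ => y f)
  rw [Finsupp.sum_of_support_subset _ (Finsupp.support_indicator_subset s _) _ (by simp)] at h1
  refine h1.trans_eq (Finset.sum_congr rfl fun f hf => ?_)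
  rw [Finsupp.sum_of_support_subset _ (Finsupp.support_indicator_subset s _) _ (by simp)]
  refine Finset.sum_congr rfl fun g hg => ?_
  rw [Finsupp.indicator_of_mem hf, Finsupp.indicator_of_mem hg]

lemma le_exp_hadamard {K M : Matrix E E ℂ} (hK : K.PosSemidef) (hM : M.PosSemidef)
    (s : Finset E) (y : E → ℂ) :
    (∑ f ∈ s, ∑ g ∈ s, star (y f) * M f g * y g) ≤
      ∑ f ∈ s, ∑ g ∈ s, star (y f) * (Complex.exp (K f g) * M f g) * y g := by
  have hs : HasSum (fun n : ℕ => ∑ f ∈ s, ∑ g ∈ s,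
      star (y f) * (((n.factorial : ℂ)⁻¹ * K f g ^ n) * M f g) * y g)
      (∑ f ∈ s, ∑ g ∈ s, star (y f) * (Complex.exp (K f g) * M f g) * y g) := by
    refine hasSum_sum fun f _ => hasSum_sum fun g _ => ?_
    refine HasSum.mul_right _ (HasSum.mul_left _ (HasSum.mul_right _ ?_))
    have := NormedSpace.exp_series_hasSum_exp' (𝕂 := ℂ) (K f g)
    rw [← Complex.exp_eq_exp_ℂ] at this
    simpa using this
  have hpow : ∀ n : ℕ, (Matrix.of fun f g => K f g ^ n * M f g : Matrix E E ℂ).PosSemidef := by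
    intro n
    induction n with
    | zero =>
      have : (Matrix.of fun f g => K f g ^ 0 * M f g : Matrix E E ℂ) = M := by
        ext f g; simp
      rwa [this]
    | succ n ih =>
      have : (Matrix.of fun f g => K f g ^ (n + 1) * M f g : Matrix E E ℂ) =
          K.hadamard (Matrix.of fun f g => K f g ^ n * M f g) := by
        ext f g
        simp only [Matrix.of_apply, Matrix.hadamard_apply]; ring
      rw [this]
      exact hK.hadamard ih
  have hnn : ∀ n : ℕ, 0 ≤ ∑ f ∈ s, ∑ g ∈ s,
      star (y f) * (((n.factorial : ℂ)⁻¹ * K f g ^ n) * M f g) * y g := by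
    intro n
    have h1 := PosSemidef.sum_nonneg (hpow n) s y
    have h2 : (0 : ℂ) ≤ (n.factorial : ℂ)⁻¹ := by
      rw [show (n.factorial : ℂ)⁻¹ = (((n.factorial : ℝ)⁻¹ : ℝ) : ℂ) by push_cast; rfl]
      exact_mod_cast inv_nonneg.mpr (Nat.cast_nonneg (α := ℝ) n.factorial)
    refine (mul_nonneg h2 h1).trans_eq ?_
    simp only [Finset.mul_sum, Matrix.of_apply]
    refine Finset.sum_congr rfl fun f _ => Finset.sum_congr rfl fun g _ => ?_
    ring
  have := sum_le_hasSum {0} (fun n _ => hnn n) hs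
  simpa using this

lemma eq_sum (a : WeylPre E h) :
    a = ∑ f ∈ ((basis h).repr a).support, (basis h).repr a f • W h f := by
  conv_lhs => rw [← (basis h).linearCombination_repr a]
  simp [Finsupp.linearCombination_apply, Finsupp.sum]

lemma star_mul_eq_sum (a : WeylPre E h) :
    star a * a = ∑ f ∈ ((basis h).repr a).support, ∑ g ∈ ((basis h).repr a).support,
      (star ((basis h).repr a f) * (basis h).repr a g) • (star (W h f) * W h g) := by
  conv_lhs => rw [eq_sum a]
  simp only [star_sum, star_smul, Finset.sum_mul_sum, smul_mul_smul_comm]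

/-- The Gram matrix of the Weyl elements in a state. -/
lemma PreState.posSemidef (ω : PreState E h) :
    (Matrix.of fun f g => ω.toLin (star (W h f) * W h g) : Matrix E E ℂ).PosSemidef := by
  refine ⟨?_, fun x => ?_⟩
  · ext f g
    exact ω.conj_symm _ _
  · have := ω.nonneg ((basis h).repr.symm x)
    rw [star_mul_eq_sum] at this
    simp only [LinearEquiv.apply_symm_apply, map_sum, map_smul, smul_eq_mul] at this
    refine this.trans_eq ?_
    refine Finset.sum_congr rfl fun f _ => Finset.sum_congr rfl fun g _ => ?_
    simp only [Matrix.of_apply]; ring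

/-- The factor `exp (-(h/4) ‖f‖²)`. -/
def qfactor (h : ℝ≥0) (f : E) : ℝ := Real.exp (-(h / 4 * ‖f‖ ^ 2))

variable (h) in
/-- The quantization map on `Δ(E, 0)`: `Q_h(W^0(f)) = exp (-(h/4) ‖f‖²) W^h(f)`. -/
def quantPre : WeylPre E 0 →ₗ[ℂ] WeylPre E h :=
  (basis 0).constr ℂ fun f => (qfactor h f : ℂ) • W h f

lemma quantPre_W (f : E) : quantPre h (W 0 f) = (qfactor h f : ℂ) • W h f := by
  rw [quantPre, ← basis_apply, Module.Basis.constr_basis]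

/-- The positive semidefinite kernel `(h/2) ⟨g, f⟩`. -/
def qkernel (h : ℝ≥0) : Matrix E E ℂ := Matrix.of fun f g => ((h : ℝ) / 2 : ℂ) * inner ℂ g f

lemma qkernel_posSemidef : (qkernel h : Matrix E E ℂ).PosSemidef := by
  have h2 : (0 : ℂ) ≤ ((h : ℝ) / 2 : ℂ) := by
    rw [show ((h : ℝ) / 2 : ℂ) = (((h : ℝ) / 2 : ℝ) : ℂ) by push_cast; rfl]
    exact_mod_cast (by positivity : (0 : ℝ) ≤ (h : ℝ) / 2)
  refine ⟨?_, fun x => ?_⟩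
  · ext f g
    simp [qkernel, Matrix.conjTranspose_apply]
  · have h3 : (0 : ℂ) ≤ inner ℂ (x.sum fun f c => conj c • f) (x.sum fun f c => conj c • f) := by
      rw [inner_self_eq_norm_sq_to_K, ← RCLike.ofReal_pow]
      exact RCLike.ofReal_nonneg.mpr (sq_nonneg _)
    refine (mul_nonneg h2 h3).trans_eq ?_
    simp only [Finsupp.sum, sum_inner, inner_sum, inner_smul_left, inner_smul_right, qkernel,
      Matrix.of_apply, Finset.mul_sum]
    refine Finset.sum_congr rfl fun f _ => Finset.sum_congr rfl fun g _ => ?_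
    simp; ring

lemma qfactor_sub (f g : E) : (qfactor h (g - f) : ℂ) • W h (g - f) =
    (qfactor h f * qfactor h g * Complex.exp (qkernel h f g) : ℂ) • (star (W h f) * W h g) := by
  rw [star_W_mul_W, smul_smul]
  congr 1
  simp only [qfactor, phase, qkernel, Matrix.of_apply, Complex.ofReal_exp, ← Complex.exp_add]
  congr 1
  have h1 : ‖g - f‖ ^ 2 = ‖g‖ ^ 2 - 2 * (inner ℂ g f).re + ‖f‖ ^ 2 := norm_sub_sq (𝕜 := ℂ) g f
  rw [h1, symp_neg_left, symp_swap g f, symp]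
  generalize hz : (inner ℂ g f : ℂ) = z
  conv_rhs => enter [1, 2]; rw [← Complex.re_add_im z]
  push_cast
  ring

/-- A Kadison-Schwarz inequality for the quantization map. -/
lemma quantPre_star_mul (ω : PreState E h) (a : WeylPre E 0) :
    ω.toLin (star (quantPre h a) * quantPre h a) ≤ ω.toLin (quantPre h (star a * a)) := by
  set x := (basis 0).repr a with hx
  have e1 : ω.toLin (star (quantPre h a) * quantPre h a) =
      ∑ f ∈ x.support, ∑ g ∈ x.support, star (qfactor h f * x f : ℂ) *
        (Matrix.of fun f g => ω.toLin (star (W h f) * W h g) : Matrix E E ℂ) f g *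
        (qfactor h g * x g) := by
    conv_lhs => rw [eq_sum a, ← hx]
    simp only [map_sum, map_smul, quantPre_W, star_sum, star_smul, Finset.sum_mul_sum,
      smul_mul_smul_comm, smul_eq_mul, Matrix.of_apply, smul_smul]
    refine Finset.sum_congr rfl fun f _ => Finset.sum_congr rfl fun g _ => ?_
    simp only [star_mul']; ring
  have e2 : ω.toLin (quantPre h (star a * a)) =
      ∑ f ∈ x.support, ∑ g ∈ x.support, star (qfactor h f * x f : ℂ) *
        (Complex.exp (qkernel h f g) *
        (Matrix.of fun f g => ω.toLin (star (W h f) * W h g) : Matrix E E ℂ) f g) *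
        (qfactor h g * x g) := by
    rw [star_mul_eq_sum, ← hx]
    simp only [map_sum, map_smul, star_W_mul_W, phase_zero, one_smul, quantPre_W, qfactor_sub,
      smul_eq_mul, Matrix.of_apply]
    refine Finset.sum_congr rfl fun f _ => Finset.sum_congr rfl fun g _ => ?_
    simp only [star_mul', Complex.star_def, Complex.conj_ofReal]; ring
  rw [e1, e2]
  exact le_exp_hadamard qkernel_posSemidef ω.posSemidef _ _

/-- The state `ω ∘ Q_h` of `Δ(E, 0)`. -/
def PreState.compQuant (ω : PreState E h) : PreState E 0 where
  toLin := ω.toLin ∘ₗ quantPre h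
  nonneg a := (ω.nonneg _).trans (quantPre_star_mul ω a)
  map_one := by
    rw [one_def, LinearMap.comp_apply, quantPre_W]
    simpa [qfactor, ← one_def] using ω.map_one

lemma norm_quantPre_le (a : WeylPre E 0) : ‖quantPre h a‖ ≤ ‖a‖ := by
  refine norm_le_of fun ω => ?_
  refine le_trans ?_ (sn_le_norm ω.compQuant a)
  exact Real.sqrt_le_sqrt (Complex.le_def.mp (quantPre_star_mul ω a)).1

variable (h) in
/-- The quantization map `Q_h : W(E, 0) → W(E, hσ)`. -/
def quant : WeylAlg E 0 →L[ℂ] WeylAlg E h :=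
  ((quantPre h).mkContinuous 1 fun a => by
    rw [one_mul]; exact norm_quantPre_le a : WeylPre E 0 →L[ℂ] WeylPre E h).completion

lemma quant_weyl (f : E) :
    quant h (weyl 0 f) = (Real.exp (-(h / 4 * ‖f‖ ^ 2)) : ℂ) • weyl h f := by
  rw [quant, weyl, ContinuousLinearMap.completion_apply_coe, LinearMap.mkContinuous_apply,
    quantPre_W, coe_smul]
  rfl

/-! ### Automorphisms induced by isometries -/

lemma symp_map (U : E →ₗᵢ[ℂ] E) (f g : E) : symp (U f) (U g) = symp f g := by
  simp [symp]

lemma phase_map (U : E →ₗᵢ[ℂ] E) (f g : E) : phase h (U f) (U g) = phase h f g := by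
  simp [phase, symp_map]

variable (h) in
/-- The linear map `W^h(f) ↦ W^h(U f)` of `Δ(E, hσ)`. -/
def secondQuantPreL (U : E →ₗᵢ[ℂ] E) : WeylPre E h →ₗ[ℂ] WeylPre E h :=
  (basis h).constr ℂ fun f => W h (U f)

lemma secondQuantPreL_W (U : E →ₗᵢ[ℂ] E) (f : E) : secondQuantPreL h U (W h f) = W h (U f) := by
  rw [secondQuantPreL, ← basis_apply, Module.Basis.constr_basis]

variable (h) in
/-- The `*`-homomorphism `W^h(f) ↦ W^h(U f)` of `Δ(E, hσ)`. -/
def secondQuantPre (U : E →ₗᵢ[ℂ] E) : WeylPre E h →⋆ₐ[ℂ] WeylPre E h where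
  toFun := secondQuantPreL h U
  map_one' := by rw [one_def, secondQuantPreL_W, map_zero]
  map_zero' := map_zero _
  map_add' := map_add _
  map_mul' a b := by
    induction a using induction with
    | zero => simp
    | add x y hx hy => simp only [add_mul, map_add, hx, hy]
    | W x f =>
      induction b using induction with
      | zero => simp
      | add x y hx hy => simp only [mul_add, map_add, hx, hy]
      | W y g =>
        simp only [smul_mul_assoc, mul_smul_comm, W_mul_W, map_smul, secondQuantPreL_W,
          phase_map, map_add]
  commutes' z := by
    rw [Algebra.algebraMap_eq_smul_one, map_smul, one_def, secondQuantPreL_W, map_zero]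
  map_star' a := by
    induction a using induction with
    | zero => simp
    | add x y hx hy => simp only [star_add, map_add, hx, hy]
    | W x f => simp only [star_smul, star_W, map_smul, secondQuantPreL_W, map_neg]

/-- The pull-back of a state along `W^h(f) ↦ W^h(U f)`. -/
def PreState.compIsometry (ω : PreState E h) (U : E →ₗᵢ[ℂ] E) : PreState E h where
  toLin := ω.toLin ∘ₗ (secondQuantPre h U).toLinearMap
  nonneg a := by
    have := ω.nonneg (secondQuantPre h U a)
    rwa [← map_star, ← map_mul] at this
  map_one := by
    change ω.toLin (secondQuantPre h U 1) = 1
    rw [_root_.map_one]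
    exact ω.map_one

lemma norm_secondQuantPre_le (U : E →ₗᵢ[ℂ] E) (a : WeylPre E h) :
    ‖secondQuantPre h U a‖ ≤ ‖a‖ := by
  refine norm_le_of fun ω => ?_
  refine le_trans (le_of_eq ?_) (sn_le_norm (ω.compIsometry U) a)
  change √(ω.toLin _).re = √(ω.toLin (secondQuantPre h U (star a * a))).re
  rw [map_mul (secondQuantPre h U), map_star (secondQuantPre h U)]

lemma continuous_secondQuantPre (U : E →ₗᵢ[ℂ] E) : Continuous (secondQuantPre h U) :=
  AddMonoidHomClass.continuous_of_bound (secondQuantPre h U) 1 fun a => by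
    rw [one_mul]; exact norm_secondQuantPre_le U a

variable (h) in
/-- The `*`-homomorphism `W^h(f) ↦ W^h(U f)` of `W(E, hσ)`. -/
def secondQuant (U : E →ₗᵢ[ℂ] E) : WeylAlg E h →⋆ₐ[ℂ] WeylAlg E h where
  __ := mapRingHom (secondQuantPre h U : WeylPre E h →+* WeylPre E h)
    (continuous_secondQuantPre U)
  commutes' z := by
    have := mapRingHom_coe (f := (secondQuantPre h U : WeylPre E h →+* WeylPre E h))
      (continuous_secondQuantPre U) (algebraMap ℂ _ z)
    have e : ((secondQuantPre h U : WeylPre E h →+* WeylPre E h)) (algebraMap ℂ _ z) =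
      algebraMap ℂ _ z := (secondQuantPre h U).commutes' z
    rw [e] at this
    exact this
  map_star' a := by
    change Completion.map (secondQuantPre h U) (star a) =
      star (Completion.map (secondQuantPre h U) a)
    have hc := uniformContinuous_addMonoidHom_of_continuous (continuous_secondQuantPre (h := h) U)
    induction a using induction_on with
    | hp =>
      exact isClosed_eq (continuous_map.comp continuous_star) (continuous_star.comp continuous_map)
    | ih a =>
      rw [← coe_star, map_coe hc, map_coe hc, ← coe_star]
      exact congrArg _ (map_star (secondQuantPre h U) a)

lemma secondQuant_weyl (U : E →ₗᵢ[ℂ] E) (f : E) :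
    secondQuant h U (weyl h f) = weyl h (U f) := by
  have := mapRingHom_coe (f := (secondQuantPre h U : WeylPre E h →+* WeylPre E h))
      (continuous_secondQuantPre U) (W h f)
  have e : ((secondQuantPre h U : WeylPre E h →+* WeylPre E h)) (W h f) = W h (U f) :=
    secondQuantPreL_W U f
  rw [e] at this
  exact this

end Algebra

/-! ### Field functions, Poisson brackets and weak derivations -/

/-- The field function `Φ_0(f)`, as a weak-* continuous function on the dual `E'`. -/
def field (f : E) : C(WeakDual ℝ E, ℂ) :=
  ⟨fun F => (F f : ℂ), Complex.continuous_ofReal.comp (WeakDual.eval_continuous f)⟩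

/-- The function `exp (i Φ_0(f))` on `E'`. -/
def expField (f : E) : C(WeakDual ℝ E, ℂ) :=
  ⟨fun F => Complex.exp (Complex.I * field f F), by fun_prop⟩

lemma expField_add (f g : E) : expField (f + g) = expField f * expField g := by
  ext F; simp [expField, field, mul_add, Complex.exp_add]

lemma expField_neg (f : E) : expField (-f) = star (expField f) := by
  ext F; simp [expField, field, ← Complex.exp_conj]

/-- The realization of `Δ(E, 0)` as an algebra of almost periodic functions on `E'`, in which
`W^0(f)` is the function `exp (i Φ_0(f))`. -/
def ev : WeylPre E 0 →ₗ[ℂ] C(WeakDual ℝ E, ℂ) := (WeylPre.basis 0).constr ℂ expField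

lemma ev_W (f : E) : ev (WeylPre.W 0 f) = expField f := by
  rw [ev, ← WeylPre.basis_apply, Module.Basis.constr_basis]

lemma ev_mul (a b : WeylPre E 0) : ev (a * b) = ev a * ev b := by
  induction a using WeylPre.induction with
  | zero => simp
  | add x y hx hy => simp only [add_mul, map_add, hx, hy]
  | W x f =>
    induction b using WeylPre.induction with
    | zero => simp
    | add x y hx hy => simp only [mul_add, map_add, hx, hy]
    | W y g =>
      simp only [smul_mul_assoc, mul_smul_comm, WeylPre.W_mul_W, phase_zero, one_smul, map_smul,
        ev_W, expField_add]

/-- The Poisson bracket of `Δ(E, 0)`: the bilinear map with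
`{W^0(f), W^0(g)} = σ(g, f) W^0(f + g)`. -/
def poisson : WeylPre E 0 →ₗ[ℂ] WeylPre E 0 →ₗ[ℂ] WeylPre E 0 :=
  (WeylPre.basis 0).constr ℂ fun f => (WeylPre.basis 0).constr ℂ fun g =>
    (symp g f : ℂ) • WeylPre.W 0 (f + g)

variable (E) in
/-- Weak derivations: linear maps from a `*`-subalgebra of `Δ(E, 0)` to the continuous functions
on `E'` that commute with the involution, satisfy the Leibniz rule, and for which
`E(δ) = {f : W^0(f) ∈ D(δ)}` is a dense subspace of `E`. -/
structure WeakDerivation where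
  /-- the domain `D(δ)` -/
  domain : StarSubalgebra ℂ (WeylPre E 0)
  /-- the underlying linear map -/
  toFun : domain →ₗ[ℂ] C(WeakDual ℝ E, ℂ)
  map_star : ∀ a, toFun (star a) = star (toFun a)
  map_mul : ∀ a b, toFun (a * b) = toFun a * ev (b : WeylPre E 0) + ev (a : WeylPre E 0) * toFun b
  smul_mem : ∀ (c : ℂ) (f : E), WeylPre.W 0 f ∈ domain → WeylPre.W 0 (c • f) ∈ domain
  dense : Dense {f : E | WeylPre.W 0 f ∈ domain}

namespace WeakDerivation

/-- Continuity: `λ ↦ δ(W^0(λ f))` is pointwise continuous on `ℂ` for all `f ∈ E(δ)`. -/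
def IsContinuous (δ : WeakDerivation E) : Prop :=
  ∀ (f : E) (hf : WeylPre.W 0 f ∈ δ.domain) (F : WeakDual ℝ E),
    Continuous fun c : ℂ => δ.toFun ⟨WeylPre.W 0 (c • f), δ.smul_mem c f hf⟩ F

/-- Linearity: `W^0(-f) δ(W^0(f))` is a real-linear functional on `E'` for all `f ∈ E(δ)`. -/
def IsLinear (δ : WeakDerivation E) : Prop :=
  ∀ (f : E) (hf : WeylPre.W 0 f ∈ δ.domain),
    IsLinearMap ℝ fun F : WeakDual ℝ E =>
      (ev (WeylPre.W 0 (-f)) * δ.toFun ⟨WeylPre.W 0 f, hf⟩) F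

/-- Pointwise closedness: if `f_n ∈ E(δ)` converges to `f` in the weak topology of `E` and
`δ(W^0(f_n))` converges pointwise to a continuous function `Ψ`, then `f ∈ E(δ)` and
`Ψ = δ(W^0(f))`. -/
def IsPointwiseClosed (δ : WeakDerivation E) : Prop :=
  ∀ (u : ℕ → E) (hu : ∀ n, WeylPre.W 0 (u n) ∈ δ.domain) (f : E) (Ψ : C(WeakDual ℝ E, ℂ)),
    (∀ F : WeakDual ℝ E, Filter.Tendsto (fun n => F (u n)) Filter.atTop (nhds (F f))) →
    (∀ F : WeakDual ℝ E, Filter.Tendsto (fun n => δ.toFun ⟨WeylPre.W 0 (u n), hu n⟩ F)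
      Filter.atTop (nhds (Ψ F))) →
    ∃ hf : WeylPre.W 0 f ∈ δ.domain, Ψ = δ.toFun ⟨WeylPre.W 0 f, hf⟩

/-- The linear map on `Δ(E, 0)` with `W^0(f) ↦ i Φ_0(L f) W^0(f)`. -/
def ofOperatorL (L : E →ₗ[ℝ] E) : WeylPre E 0 →ₗ[ℂ] C(WeakDual ℝ E, ℂ) :=
  (WeylPre.basis 0).constr ℂ fun f => Complex.I • (field (L f) * ev (WeylPre.W 0 f))

lemma ofOperatorL_W (L : E →ₗ[ℝ] E) (f : E) :
    ofOperatorL L (WeylPre.W 0 f) = Complex.I • (field (L f) * ev (WeylPre.W 0 f)) :=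
  Module.Basis.constr_basis _ _ _ _

lemma ofOperatorL_star (L : E →ₗ[ℝ] E) (a : WeylPre E 0) :
    ofOperatorL L (star a) = star (ofOperatorL L a) := by
  induction a using WeylPre.induction with
  | zero => simp
  | add x y hx hy => simp only [star_add, map_add, hx, hy]
  | W x f =>
    ext F
    simp [WeylPre.star_W, ofOperatorL_W, ev_W, expField_neg, field]

lemma ofOperatorL_mul (L : E →ₗ[ℝ] E) (a b : WeylPre E 0) :
    ofOperatorL L (a * b) = ofOperatorL L a * ev b + ev a * ofOperatorL L b := by
  induction a using WeylPre.induction with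
  | zero => simp
  | add x y hx hy => simp only [add_mul, map_add, hx, hy]; ring
  | W x f =>
    induction b using WeylPre.induction with
    | zero => simp
    | add x y hx hy => simp only [mul_add, map_add, hx, hy]; ring
    | W y g =>
      ext F
      simp [WeylPre.W_mul_W, phase_zero, ofOperatorL_W, ev_W, expField_add, field]
      ring

/-- The weak derivation with domain `Δ(E, 0)` and `δ(W^0(f)) = i Φ_0(L f) W^0(f)`, for an
everywhere defined operator `L` on `E`. -/
def ofOperator (L : E →ₗ[ℝ] E) : WeakDerivation E where
  domain := ⊤
  toFun := ofOperatorL L ∘ₗ (⊤ : StarSubalgebra ℂ (WeylPre E 0)).subtype.toLinearMap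
  map_star a := ofOperatorL_star L a
  map_mul a b := ofOperatorL_mul L a b
  smul_mem _ _ _ := trivial
  dense := by simp

end WeakDerivation

/-! ### Regular classical states and the weak KMS condition -/

namespace WeylState

/-- `C²`-states of `W(E, 0)`: the GNS representation `π` is regular, and the cyclic vector `Ω`
lies in the domain of the generator of the one-parameter group `t ↦ π(W^0(t f))` for all `f`. -/
def IsC2 (ω : WeylState E 0) : Prop :=
  (∀ (f : E) (ξ : ω.toPLM.GNS), Continuous fun t : ℝ => ω.toPLM.gnsStarAlgHom (weyl 0 (t • f)) ξ) ∧
  ∀ f : E, DifferentiableAt ℝ (fun t : ℝ => ω.toPLM.gnsStarAlgHom (weyl 0 (t • f))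
    ((ω.toPLM.toPreGNS 1 : ω.toPLM.PreGNS) : ω.toPLM.GNS)) 0

/-- The expectation `ω(Φ_0(f) W^0(g)) = -i d/dt ω(W^0(g + t f))|_{t = 0}`. -/
def fieldExp (ω : WeylState E 0) (f g : E) : ℂ :=
  -Complex.I * deriv (fun t : ℝ => ω (weyl 0 (g + t • f))) 0

/-- The relation `ω(Ψ) = z`, for functions `Ψ` in the linear span of the products
`Φ_0(f) W^0(g)`. For a `C²`-state, `z` does not depend on the representation of `Ψ`. -/
def HasFieldExpectation (ω : WeylState E 0) (Ψ : C(WeakDual ℝ E, ℂ)) (z : ℂ) : Prop :=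
  ∃ (n : ℕ) (c : Fin n → ℂ) (f g : Fin n → E),
    Ψ = ∑ i, c i • (field (f i) * ev (WeylPre.W 0 (g i))) ∧
    z = ∑ i, c i * ω.fieldExp (f i) (g i)

/-- The weak `(δ, β)`-KMS condition `ω({a, b}) = β ω(b δ(a))` for all `a, b ∈ D(δ)`. -/
def IsWeakKMS (ω : WeylState E 0) (δ : WeakDerivation E) (β : ℝ) : Prop :=
  δ.IsContinuous ∧ δ.IsLinear ∧ δ.IsPointwiseClosed ∧ ω.IsC2 ∧
  ∀ a b : δ.domain, ∃ z : ℂ,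
    ω.HasFieldExpectation (ev (b : WeylPre E 0) * δ.toFun a) z ∧
    ω (poisson (a : WeylPre E 0) (b : WeylPre E 0) : WeylPre E 0) = β * z

/-- The `(τ, b)`-KMS condition: for all `A`, `B` there is a bounded continuous function on the
strip `0 ≤ Im z ≤ b`, holomorphic in its interior, with boundary values `ω(A τ_t(B))` at `t` and
`ω(τ_t(B) A)` at `t + i b`. No continuity of `t ↦ τ_t` is required. -/
def IsKMS {h : ℝ≥0} (ω : WeylState E h) (τ : ℝ → WeylAlg E h →⋆ₐ[ℂ] WeylAlg E h)
    (b : ℝ) : Prop :=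
  ∀ A B : WeylAlg E h, ∃ F : ℂ → ℂ,
    ContinuousOn F {z | 0 ≤ z.im ∧ z.im ≤ b} ∧
    DifferentiableOn ℂ F {z | 0 < z.im ∧ z.im < b} ∧
    (∃ C : ℝ, ∀ z : ℂ, 0 ≤ z.im → z.im ≤ b → ‖F z‖ ≤ C) ∧
    ∀ t : ℝ, F t = ω (A * τ t B) ∧ F (t + Complex.I * b) = ω (τ t B * A)

end WeylState

/-! ### The free gas -/

open MeasureTheory
open scoped SchwartzMap FourierTransform Laplacian

/-- The test function space `S(ℝ^ν)`, with the inner product of `L²(ℝ^ν)`. -/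
def TestSpace (ν : ℕ) : Type := 𝓢(EuclideanSpace ℝ (Fin ν), ℂ)

namespace TestSpace

variable {ν : ℕ}

instance : AddCommGroup (TestSpace ν) :=
  inferInstanceAs (AddCommGroup 𝓢(EuclideanSpace ℝ (Fin ν), ℂ))

instance : Module ℂ (TestSpace ν) :=
  inferInstanceAs (Module ℂ 𝓢(EuclideanSpace ℝ (Fin ν), ℂ))

/-- An element of `TestSpace ν`, viewed as a Schwartz function. -/
def toSchwartz : TestSpace ν ≃ₗ[ℂ] 𝓢(EuclideanSpace ℝ (Fin ν), ℂ) := LinearEquiv.refl ℂ _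

/-- The embedding of `S(ℝ^ν)` into `L²(ℝ^ν)`. -/
def toL2 : TestSpace ν →ₗ[ℂ] Lp ℂ 2 (volume : Measure (EuclideanSpace ℝ (Fin ν))) :=
  (SchwartzMap.toLpCLM ℂ ℂ 2 : 𝓢(EuclideanSpace ℝ (Fin ν), ℂ) →L[ℂ] _).toLinearMap ∘ₗ
    toSchwartz.toLinearMap

lemma toL2_injective : Function.Injective (toL2 (ν := ν)) :=
  SchwartzMap.injective_toLp 2 (volume : Measure (EuclideanSpace ℝ (Fin ν)))

instance : NormedAddCommGroup (TestSpace ν) :=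
  NormedAddCommGroup.induced _ _ (toL2 (ν := ν)) toL2_injective

lemma norm_eq (f : TestSpace ν) : ‖f‖ = ‖toL2 f‖ := rfl

instance : InnerProductSpace ℂ (TestSpace ν) where
  norm_smul_le c f := by rw [norm_eq, norm_eq, map_smul, norm_smul]
  inner f g := inner ℂ (toL2 f) (toL2 g)
  norm_sq_eq_re_inner f := norm_sq_eq_re_inner (𝕜 := ℂ) (toL2 f)
  conj_inner_symm f g := inner_conj_symm (toL2 f) (toL2 g)
  add_left f g k := by rw [map_add, inner_add_left]
  smul_left f g c := by rw [map_smul, inner_smul_left]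

lemma inner_eq (f g : TestSpace ν) : inner ℂ f g =
    ∫ x, conj (toSchwartz f x) * toSchwartz g x := by
  refine (SchwartzMap.inner_toL2_toL2_eq (toSchwartz f) (toSchwartz g)).trans ?_
  refine integral_congr_ae (Filter.Eventually.of_forall fun x => ?_)
  exact (RCLike.inner_apply' _ _)

end TestSpace

variable {ν : ℕ}

open TestSpace

/-- The one-particle Hamiltonian `H = -Δ/2` on `S(ℝ^ν)`. -/
def hamiltonian : TestSpace ν →ₗ[ℂ] TestSpace ν where
  toFun f := toSchwartz.symm ((-(1 / 2) : ℂ) • Δ (toSchwartz f))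
  map_add' f g := by
    simp only [map_add, ← SchwartzMap.laplacianCLM_eq (𝕜 := ℂ), smul_add]
  map_smul' c f := by
    simp only [map_smul, ← SchwartzMap.laplacianCLM_eq (𝕜 := ℂ), RingHom.id_apply, smul_comm c]

variable (ν) in
/-- The weak derivation `δ_0^0(W^0(f)) = i Φ_0(i H f) W^0(f)`, `f ∈ S(ℝ^ν)`. -/
def freeDerivation : WeakDerivation (TestSpace ν) :=
  WeakDerivation.ofOperator ((Complex.I • hamiltonian).restrictScalars ℝ)

/-- The value of the classical kinetic energy `p²/2` at `p = 2π ξ`; `H` acts in Fourier space as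
multiplication by this function, in the normalization `∫ exp (-2π i ⟨ξ, x⟩) f(x) dx` of the
Fourier transform. -/
def energy (ξ : EuclideanSpace ℝ (Fin ν)) : ℝ := 2 * Real.pi ^ 2 * ‖ξ‖ ^ 2

lemma temperate_cexp : Function.HasTemperateGrowth fun x : ℝ => Complex.exp (Complex.I * x) := by
  refine ⟨(contDiff_const.mul Complex.ofRealCLM.contDiff).cexp, fun n => ⟨0, 1, fun x => ?_⟩⟩
  have h : iteratedDeriv n (fun x : ℝ => Complex.exp (Complex.I * x)) =
      fun x : ℝ => Complex.I ^ n * Complex.exp (Complex.I * x) := by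
    induction n with
    | zero => simp
    | succ n ih =>
      rw [iteratedDeriv_succ, ih]
      ext x
      have h1 : HasDerivAt (fun x : ℝ => Complex.I * (x : ℂ)) Complex.I x := by
        simpa using (Complex.ofRealCLM.hasDerivAt (x := x)).const_mul Complex.I
      rw [(h1.cexp.const_mul (Complex.I ^ n)).deriv]; ring
  rw [norm_iteratedFDeriv_eq_norm_iteratedDeriv, h]
  simp [mul_comm Complex.I, Complex.norm_exp_ofReal_mul_I]

lemma temperate_energy (t : ℝ) : Function.HasTemperateGrowth
    fun ξ : EuclideanSpace ℝ (Fin ν) => Complex.exp (Complex.I * (t * energy ξ : ℝ)) := by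
  have h1 : Function.HasTemperateGrowth fun ξ : EuclideanSpace ℝ (Fin ν) => t * energy ξ := by
    unfold energy; fun_prop
  exact temperate_cexp.comp h1

lemma norm_multiplier (t : ℝ) (f : 𝓢(EuclideanSpace ℝ (Fin ν), ℂ)) :
    ‖(SchwartzMap.fourierMultiplierCLM ℂ (fun ξ : EuclideanSpace ℝ (Fin ν) =>
        Complex.exp (Complex.I * (t * energy ξ : ℝ))) f).toLp 2‖ = ‖f.toLp 2‖ := by
  rw [← SchwartzMap.norm_fourier_toL2_eq, ← SchwartzMap.norm_fourier_toL2_eq f,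
    SchwartzMap.fourierMultiplierCLM_apply, FourierTransform.fourier_fourierInv_eq,
    SchwartzMap.norm_toLp, SchwartzMap.norm_toLp]
  congr 1
  refine eLpNorm_congr_norm_ae (Filter.Eventually.of_forall fun x => ?_)
  rw [SchwartzMap.smulLeftCLM_apply_apply (temperate_energy t), norm_smul, mul_comm Complex.I,
    Complex.norm_exp_ofReal_mul_I, one_mul]

/-- The unitary group `e^{itH}` on `S(ℝ^ν)`: in Fourier space, multiplication by
`exp (i t p²/2)`. -/
def freeEvolution (t : ℝ) : TestSpace ν →ₗᵢ[ℂ] TestSpace ν where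
  toLinearMap := toSchwartz.symm.toLinearMap ∘ₗ
    (SchwartzMap.fourierMultiplierCLM ℂ fun ξ : EuclideanSpace ℝ (Fin ν) =>
      Complex.exp (Complex.I * (t * energy ξ : ℝ))).toLinearMap ∘ₗ toSchwartz.toLinearMap
  norm_map' f := norm_multiplier t (toSchwartz f)

/-- The dynamics `τ_{h,t}(W^h(f)) = W^h(e^{itH} f)`. -/
def freeDynamics (h : ℝ≥0) (t : ℝ) : WeylAlg (TestSpace ν) h →⋆ₐ[ℂ] WeylAlg (TestSpace ν) h :=
  secondQuant h (freeEvolution t)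

/-- The quadratic form `⟨f, φ(H) f⟩`, computed in Fourier space. -/
def kineticForm (φ : ℝ → ℝ) (f : TestSpace ν) : ℝ :=
  ∫ ξ : EuclideanSpace ℝ (Fin ν), φ (energy ξ) *
    ‖𝓕 (toSchwartz f) ξ‖ ^ 2

/-- The integral `∫ f(x) dx`. -/
def total (f : TestSpace ν) : ℂ :=
  ∫ x : EuclideanSpace ℝ (Fin ν), toSchwartz f x

variable (ν) in
/-- The critical density `ρ_c(b) = ∫ (dp/(2π)^ν) e^{-b p²/2} (1 - e^{-b p²/2})⁻¹`. -/
def criticalDensity (b : ℝ) : ℝ :=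
  ∫ p : EuclideanSpace ℝ (Fin ν), ((2 * Real.pi) ^ ν)⁻¹ *
    (Real.exp (-(b * (‖p‖ ^ 2 / 2))) * (1 - Real.exp (-(b * (‖p‖ ^ 2 / 2))))⁻¹)

end FreeBose

end

open FreeBose Filter Topology

noncomputable section

namespace FreeBose

open WeylPre UniformSpace

variable {E : Type*} [NormedAddCommGroup E] [InnerProductSpace ℂ E] {h : ℝ≥0}

/-! ### States of the Weyl algebra from states of `Δ(E, hσ)` -/

namespace PreState

/-! All states involved are quasi-free: `ω(W(f)) = exp(-K(f, f)/2)` for a positive semidefinite,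
real-bilinear kernel `K` with `K(f, g) - K(g, f) = i h σ(f, g)`. The cocycle supplies the
antisymmetric part of `K` in the exponent, so that `ω(W(f)* W(g))` is `gen f * gen g * exp (K f g)`
(`Covariance.phase_mul_gen`). By Schur's product theorem the entrywise exponential of a positive
kernel dominates the all-ones kernel, which gives positivity. The functional extends to the
completion because the norm is a supremum over states.

For the free gas, `K(f, g) = ⟨f, w₁ g⟩ + ⟨g, w₂ f⟩ + c Re (conj (∫ f) ∫ g)`, with multiplication
operators `w₁`, `w₂` in Fourier space and `w₁ - w₂ = h/2`. The quantum choice is `w₁ = (h/2)(1 -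
e^{-βhH})⁻¹`, `w₂ = e^{-βhH} w₁`; the classical one is `w₁ = w₂ = (2βH)⁻¹`. Both are at most a
constant plus a multiple of `1/p²`, which is locally integrable exactly because `ν ≥ 3`. The
condensate sees only `∫ f`, the Fourier transform at zero momentum, where the energy vanishes. It is
therefore unchanged by `e^{itH}` and is zero on the range of `H`, so every condensate density is
compatible with the same KMS condition.

Quantum KMS (`gasCovariance_isKMS`): the relation `w₂ = e^{-βhH} w₁` turns the exchange of the two
Weyl elements into the shift `t ↦ t + iβh` of the two-point functions. This settles Weyl elements;
the three lines theorem carries it to norm limits. Classical KMS (`Covariance.weakKMS`): on Weyl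
elements it reduces to `β K(iHf, g) = σ(f, g)`, that is, to the cancellation of `H` against
`(βH)⁻¹`. The `C²` property holds because `t ↦ π(W(tf))Ω` has a Gaussian Gram kernel, which makes
its difference quotients Cauchy.

Classical limit: `Q_h` and states are contractive, so convergence need only be checked on Weyl
elements (`tendsto_quant_of_weyl`). There `(h/2) coth(βhH/2)` tends to `(βH)⁻¹` under the majorant
`h + (βH)⁻¹`, the factor `exp(-h‖f‖²/4)` tends to `1`, and the condensate weight `2^ν h (ρ̄ - ρ_c)`
tends to `2^ν α`. -/

lemma norm_toLin_le (ω : PreState E h) (a : WeylPre E h) : ‖ω.toLin a‖ ≤ ‖a‖ := by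
  have := ω.cauchy_schwarz 1 a
  rw [star_one, one_mul, ω.sn_one, one_mul] at this
  exact this.trans (sn_le_norm ω a)

/-- The continuous extension of a state of `Δ(E, hσ)` to `W(E, hσ)`. -/
def extend (ω : PreState E h) : WeylAlg E h →L[ℂ] ℂ :=
  (ω.toLin.mkContinuous 1 fun a => by rw [one_mul]; exact ω.norm_toLin_le a :
    WeylPre E h →L[ℂ] ℂ).extend (Completion.toComplL : WeylPre E h →L[ℂ] WeylAlg E h)

lemma extend_coe (ω : PreState E h) (a : WeylPre E h) : ω.extend (a : WeylAlg E h) = ω.toLin a :=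
  ContinuousLinearMap.extend_eq _ Completion.denseRange_coe
    (Completion.isUniformInducing_coe _) a

lemma extend_star_mul_nonneg (ω : PreState E h) (a : WeylAlg E h) : 0 ≤ ω.extend (star a * a) := by
  induction a using Completion.induction_on with
  | hp =>
    exact isClosed_le continuous_const
      (ω.extend.continuous.comp (continuous_star.mul continuous_id))
  | ih a =>
    rw [← coe_star, ← Completion.coe_mul, extend_coe]
    exact ω.nonneg a

/-- A state of `Δ(E, hσ)` extends to a state of its completion. -/
def toWeylState (ω : PreState E h) : WeylState E h where
  toPLM := PositiveLinearMap.mk₀ ω.extend.toLinearMap fun a ha => by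
    obtain ⟨b, rfl⟩ := CStarAlgebra.nonneg_iff_eq_star_mul_self.mp ha
    exact ω.extend_star_mul_nonneg b
  map_one := by
    change ω.extend 1 = 1
    rw [← Completion.coe_one, extend_coe, ω.map_one]

lemma toWeylState_weyl (ω : PreState E h) (f : E) :
    ω.toWeylState (weyl h f) = ω.toLin (W h f) :=
  ω.extend_coe _

end PreState

/-! ### Weyl relations and restriction of states in the completion -/

lemma weyl_mul_weyl (f g : E) : weyl h f * weyl h g = phase h f g • weyl h (f + g) := by
  rw [weyl, weyl, ← Completion.coe_mul, W_mul_W, Completion.coe_smul]; rfl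

lemma star_weyl (f : E) : star (weyl h f) = weyl h (-f) := by
  rw [weyl, ← coe_star, star_W]; rfl

namespace WeylState

/-- The restriction of a state of `W(E, hσ)` to `Δ(E, hσ)`. -/
def restrict (ω : WeylState E h) : PreState E h where
  toLin := ω.toPLM.toLinearMap ∘ₗ (Completion.toComplL : WeylPre E h →L[ℂ] WeylAlg E h).toLinearMap
  nonneg a := by
    change 0 ≤ ω.toPLM ((star a * a : WeylPre E h) : WeylAlg E h)
    rw [Completion.coe_mul, coe_star]
    exact map_nonneg ω.toPLM (star_mul_self_nonneg _)
  map_one := ω.map_one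

lemma continuous (ω : WeylState E h) : Continuous ω.toPLM := map_continuous ω.toPLM

lemma norm_le (ω : WeylState E h) (a : WeylAlg E h) : ‖ω a‖ ≤ ‖a‖ := by
  induction a using Completion.induction_on with
  | hp => exact isClosed_le ω.continuous.norm continuous_norm
  | ih a =>
    rw [Completion.norm_coe]
    exact ω.restrict.norm_toLin_le a

end WeylState

/-! ### Quasi-free states -/

variable (E h) in
/-- Covariances of quasi-free states: real-bilinear positive kernels whose antisymmetric part
is `(i/2) h σ`. -/
structure Covariance where
  /-- the underlying kernel -/
  toFun : E → E → ℂ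
  posSemidef : (Matrix.of toFun : Matrix E E ℂ).PosSemidef
  add_right : ∀ f g k, toFun f (g + k) = toFun f g + toFun f k
  smul_right : ∀ (t : ℝ) f g, toFun f (t • g) = t * toFun f g
  sub_swap : ∀ f g, toFun f g - toFun g f = Complex.I * (h * symp f g : ℝ)

namespace Covariance

variable (K : Covariance E h)

instance : CoeFun (Covariance E h) (fun _ => E → E → ℂ) := ⟨toFun⟩

lemma conj_eq (f g : E) : conj (K f g) = K g f := K.posSemidef.1.apply g f

lemma add_left (f g k : E) : K (f + g) k = K f k + K g k := by
  rw [← K.conj_eq, K.add_right, map_add, K.conj_eq, K.conj_eq]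

lemma smul_left (t : ℝ) (f g : E) : K (t • f) g = t * K f g := by
  rw [← K.conj_eq, K.smul_right, map_mul, K.conj_eq, Complex.conj_ofReal]

lemma zero_right (f : E) : K f 0 = 0 := by simpa using K.add_right f 0 0

lemma neg_right (f g : E) : K f (-g) = -K f g := by
  have := K.add_right f g (-g)
  rw [add_neg_cancel, K.zero_right] at this
  linear_combination -this

lemma neg_left (f g : E) : K (-f) g = -K f g := by
  rw [← K.conj_eq, K.neg_right, map_neg, K.conj_eq]

lemma self_eq_re (f : E) : K f f = ((K f f).re : ℂ) :=
  (Complex.conj_eq_iff_re.mp (K.conj_eq f f)).symm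

/-- The generating function `exp (-K(f, f)/2)`. -/
def gen (f : E) : ℂ := Complex.exp (-(K f f / 2))

lemma gen_zero : K.gen 0 = 1 := by simp [gen, K.zero_right]

lemma gen_neg (f : E) : K.gen (-f) = K.gen f := by simp [gen, K.neg_left, K.neg_right]

lemma conj_gen (f : E) : conj (K.gen f) = K.gen f := by
  rw [gen, ← Complex.exp_conj, map_neg, map_div₀, K.conj_eq]; simp [map_ofNat]

/-- Expanding `K(f + g, f + g)` leaves the cross term `(K f g + K g f)/2`, and the cocycle
contributes `(K f g - K g f)/2`; together they make `K f g`. Both positivity and the KMS condition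
rest on this. -/
lemma phase_mul_gen (f g : E) :
    phase h f g * K.gen (f + g) = K.gen f * K.gen g * Complex.exp (-K f g) := by
  simp only [phase, gen, ← Complex.exp_add]
  congr 1
  have := K.sub_swap f g
  rw [K.add_left, K.add_right, K.add_right]
  linear_combination (1 / 2) * this

/-- The quasi-free state of `Δ(E, hσ)` with covariance `K`. -/
def preState : PreState E h where
  toLin := (basis h).constr ℂ K.gen
  nonneg a := by
    have hW (f : E) : (basis h).constr ℂ K.gen (W h f) = K.gen f := by
      rw [← basis_apply, Module.Basis.constr_basis]
    set x := (basis h).repr a with hx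
    have hM : (Matrix.of fun _ _ => 1 : Matrix E E ℂ).PosSemidef := by
      refine ⟨by ext; simp, fun y => ?_⟩
      have e : (y.sum fun i xi => y.sum fun j xj =>
          star xi * (Matrix.of fun _ _ => 1 : Matrix E E ℂ) i j * xj) =
          star (∑ i ∈ y.support, y i) * ∑ i ∈ y.support, y i := by
        simp [Finsupp.sum, Finset.sum_mul_sum]
      rw [e]
      exact star_mul_self_nonneg _
    have e : (basis h).constr ℂ K.gen (star a * a) = ∑ f ∈ x.support, ∑ g ∈ x.support,
        star (K.gen f * x f) * (Complex.exp (K f g) *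
          (Matrix.of fun _ _ => 1 : Matrix E E ℂ) f g) * (K.gen g * x g) := by
      rw [star_mul_eq_sum, ← hx]
      simp only [map_sum, map_smul, star_W_mul_W, hW, smul_eq_mul, Matrix.of_apply]
      refine Finset.sum_congr rfl fun f _ => Finset.sum_congr rfl fun g _ => ?_
      have := K.phase_mul_gen (-f) g
      rw [K.gen_neg, K.neg_left, neg_neg] at this
      simp only [sub_eq_neg_add, this, star_mul', Complex.star_def, K.conj_gen]
      ring
    rw [e]
    -- The all-ones kernel gives the square of a modulus, and the exponential of `K` dominates it.
    refine (PosSemidef.sum_nonneg hM x.support fun f => K.gen f * x f).trans ?_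
    exact le_exp_hadamard K.posSemidef hM _ _
  map_one := by
    rw [one_def, ← basis_apply, Module.Basis.constr_basis, K.gen_zero]

lemma preState_W (f : E) : K.preState.toLin (W h f) = K.gen f := by
  rw [← basis_apply]; exact Module.Basis.constr_basis _ _ _ _

/-- The quasi-free state of `W(E, hσ)` with covariance `K`. -/
def state : WeylState E h := K.preState.toWeylState

lemma state_weyl (f : E) : K.state (weyl h f) = K.gen f := by
  rw [state, PreState.toWeylState_weyl, preState_W]

end Covariance

/-! ### Boundary values of bounded holomorphic functions on a strip -/

/-- `u` and `v` are the boundary values, on `Im z = 0` and `Im z = b`, of a bounded continuous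
function on the closed strip that is holomorphic in the interior. -/
def IsStripPair (b : ℝ) (u v : ℝ → ℂ) : Prop :=
  ∃ F : ℂ → ℂ,
    ContinuousOn F {z | 0 ≤ z.im ∧ z.im ≤ b} ∧
    DifferentiableOn ℂ F {z | 0 < z.im ∧ z.im < b} ∧
    (∃ C : ℝ, ∀ z : ℂ, 0 ≤ z.im → z.im ≤ b → ‖F z‖ ≤ C) ∧
    ∀ t : ℝ, F t = u t ∧ F (t + Complex.I * b) = v t

/-- The three lines bound on a strip. -/
lemma norm_le_of_strip {b : ℝ} (hb : 0 < b) {F : ℂ → ℂ} {M : ℝ}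
    (hc : ContinuousOn F {z | 0 ≤ z.im ∧ z.im ≤ b})
    (hd : DifferentiableOn ℂ F {z | 0 < z.im ∧ z.im < b})
    (hB : ∃ C : ℝ, ∀ z : ℂ, 0 ≤ z.im → z.im ≤ b → ‖F z‖ ≤ C)
    (h0 : ∀ t : ℝ, ‖F t‖ ≤ M) (h1 : ∀ t : ℝ, ‖F (t + Complex.I * b)‖ ≤ M)
    {z : ℂ} (hz0 : 0 ≤ z.im) (hzb : z.im ≤ b) : ‖F z‖ ≤ M := by
  refine PhragmenLindelof.horizontal_strip (a := 0) (b := b) ⟨hd, hc.mono ?_⟩ ?_ ?_ ?_ hz0 hzb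
  · refine closure_minimal (fun z hz => ⟨hz.1.le, hz.2.le⟩) ?_
    exact (isClosed_le continuous_const Complex.continuous_im).inter
      (isClosed_le Complex.continuous_im continuous_const)
  · obtain ⟨C, hC⟩ := hB
    -- A bounded function meets the Phragmén–Lindelöf growth condition with rate `0 < π / b` and
    -- constant `0`.
    refine ⟨0, div_pos Real.pi_pos (by simpa using hb), 0, Asymptotics.IsBigO.of_bound C ?_⟩
    refine Filter.Eventually.filter_mono inf_le_right ?_
    refine eventually_principal.mpr fun z hz => ?_
    simpa using hC z hz.1.le hz.2.le
  · intro w hw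
    have : w = (w.re : ℂ) := Complex.ext rfl (by simpa using hw)
    rw [this]; exact h0 _
  · intro w hw
    have : w = (w.re : ℂ) + Complex.I * b := Complex.ext (by simp) (by simpa using hw)
    rw [this]; exact h1 _

namespace IsStripPair

variable {b : ℝ} {u v u' v' : ℝ → ℂ}

lemma zero : IsStripPair b (fun _ => 0) (fun _ => 0) :=
  ⟨fun _ => 0, continuousOn_const, differentiableOn_const 0, ⟨0, by simp⟩, by simp⟩

lemma add (h : IsStripPair b u v) (h' : IsStripPair b u' v') :
    IsStripPair b (fun t => u t + u' t) (fun t => v t + v' t) := by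
  obtain ⟨F, hc, hd, ⟨C, hC⟩, hF⟩ := h
  obtain ⟨F', hc', hd', ⟨C', hC'⟩, hF'⟩ := h'
  refine ⟨fun z => F z + F' z, hc.add hc', hd.add hd', ⟨C + C', fun z h0 h1 => ?_⟩, fun t => ?_⟩
  · exact (norm_add_le _ _).trans (add_le_add (hC z h0 h1) (hC' z h0 h1))
  · simp only [hF, hF', and_self]

lemma const_mul (c : ℂ) (h : IsStripPair b u v) :
    IsStripPair b (fun t => c * u t) (fun t => c * v t) := by
  obtain ⟨F, hc, hd, ⟨C, hC⟩, hF⟩ := h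
  refine ⟨fun z => c * F z, continuousOn_const.mul hc, hd.const_mul c,
    ⟨‖c‖ * C, fun z h0 h1 => ?_⟩, fun t => ?_⟩
  · rw [norm_mul]; exact mul_le_mul_of_nonneg_left (hC z h0 h1) (norm_nonneg c)
  · simp only [hF, and_self]

/-- Uniform limits of boundary values are boundary values. -/
lemma of_tendstoUniformly (hb : 0 < b) {U V : ℕ → ℝ → ℂ} (h : ∀ n, IsStripPair b (U n) (V n))
    (hu : TendstoUniformly U u atTop) (hv : TendstoUniformly V v atTop) : IsStripPair b u v := by
  choose F hc hd hB hF using h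
  -- The three lines bound for `F m - F n` turns uniform Cauchy sequences on the two boundary lines
  -- into one on the whole strip, so the limit exists, is continuous and is holomorphic inside.
  have hcau : UniformCauchySeqOn F atTop {z | 0 ≤ z.im ∧ z.im ≤ b} := by
    rw [Metric.uniformCauchySeqOn_iff]
    intro ε hε
    obtain ⟨N, hN⟩ := Metric.uniformCauchySeqOn_iff.mp
      (tendstoUniformlyOn_univ.mpr hu).uniformCauchySeqOn (ε / 2) (half_pos hε)
    obtain ⟨N', hN'⟩ := Metric.uniformCauchySeqOn_iff.mp
      (tendstoUniformlyOn_univ.mpr hv).uniformCauchySeqOn (ε / 2) (half_pos hε)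
    refine ⟨max N N', fun m hm n hn z hz => ?_⟩
    rw [dist_eq_norm]
    refine lt_of_le_of_lt ?_ (half_lt_self hε)
    refine norm_le_of_strip (F := fun z => F m z - F n z) hb ((hc m).sub (hc n))
      ((hd m).sub (hd n)) ?_ (fun t => ?_) (fun t => ?_) hz.1 hz.2
    · obtain ⟨C, hC⟩ := hB m
      obtain ⟨C', hC'⟩ := hB n
      exact ⟨C + C', fun z h0 h1 =>
        (norm_sub_le _ _).trans (add_le_add (hC z h0 h1) (hC' z h0 h1))⟩
    · rw [(hF m t).1, (hF n t).1, ← dist_eq_norm]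
      exact (hN m ((le_max_left _ _).trans hm) n ((le_max_left _ _).trans hn) t trivial).le
    · rw [(hF m t).2, (hF n t).2, ← dist_eq_norm]
      exact (hN' m ((le_max_right _ _).trans hm) n ((le_max_right _ _).trans hn) t trivial).le
  have hlim : ∀ z : ℂ, 0 ≤ z.im ∧ z.im ≤ b →
      Tendsto (fun n => F n z) atTop (𝓝 (limUnder atTop fun n => F n z)) := fun z hz =>
    (hcau.cauchySeq hz).tendsto_limUnder
  have hunif := hcau.tendstoUniformlyOn_of_tendsto hlim
  refine ⟨fun z => limUnder atTop fun n => F n z,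
    hunif.continuousOn (Frequently.of_forall hc), ?_, ?_, fun t => ⟨?_, ?_⟩⟩
  · have hsub : {z : ℂ | 0 < z.im ∧ z.im < b} ⊆ {z | 0 ≤ z.im ∧ z.im ≤ b} :=
      fun z hz => ⟨hz.1.le, hz.2.le⟩
    refine (hunif.mono hsub).tendstoLocallyUniformlyOn.differentiableOn
      (Eventually.of_forall hd) ?_
    exact (isOpen_lt continuous_const Complex.continuous_im).inter
      (isOpen_lt Complex.continuous_im continuous_const)
  · obtain ⟨n, hn⟩ := (Metric.tendstoUniformlyOn_iff.mp hunif 1 one_pos).exists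
    obtain ⟨C, hC⟩ := hB n
    refine ⟨1 + C, fun z h0 h1 => ?_⟩
    have h2 := (hn z ⟨h0, h1⟩).le
    rw [dist_eq_norm] at h2
    have h3 := norm_add_le ((limUnder atTop fun n => F n z) - F n z) (F n z)
    rw [sub_add_cancel] at h3
    exact h3.trans (add_le_add h2 (hC z h0 h1))
  · refine tendsto_nhds_unique (hlim t (by simpa using hb.le)) ?_
    simp only [(hF _ t).1]
    exact hu.tendsto_at t
  · refine tendsto_nhds_unique (hlim (t + Complex.I * b) (by simpa using hb.le)) ?_
    simp only [(hF _ t).2]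
    exact hv.tendsto_at t

end IsStripPair

/-! ### The KMS condition -/

namespace WeylState

variable {ω : WeylState E h} {τ : ℝ → WeylAlg E h →⋆ₐ[ℂ] WeylAlg E h} {b : ℝ}

/-- The KMS condition holds if it holds for the Weyl elements. -/
lemma isKMS_of_weyl (hb : 0 < b)
    (hW : ∀ f g : E, IsStripPair b (fun t => ω (weyl h f * τ t (weyl h g)))
      (fun t => ω (τ t (weyl h g) * weyl h f))) : ω.IsKMS τ b := by
  -- The set of admissible `A` is closed: `τ t` and `ω` are contractive, so norm convergence of `A
  -- n` gives convergence of both boundary functions uniformly in `t`. The same holds for `B` below.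
  have closed_left (B : WeylAlg E h) : IsClosed {A : WeylAlg E h |
      IsStripPair b (fun t => ω (A * τ t B)) (fun t => ω (τ t B * A))} := by
    refine IsSeqClosed.isClosed fun A A₀ hA hlim => ?_
    have hlim' : Tendsto (fun n => ‖A₀ - A n‖ * ‖B‖) atTop (𝓝 0) := by
      have := (tendsto_const_nhds (x := A₀)).sub hlim
      simpa using (this.norm.mul_const ‖B‖)
    refine IsStripPair.of_tendstoUniformly hb hA ?_ ?_
    all_goals
      refine Metric.tendstoUniformly_iff.mpr fun ε hε => ?_
      filter_upwards [hlim'.eventually_lt_const hε] with n hn t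
      refine lt_of_le_of_lt ?_ hn
      rw [dist_eq_norm, ← map_sub]
    · rw [← sub_mul]
      exact (ω.norm_le _).trans ((norm_mul_le _ _).trans
        (mul_le_mul_of_nonneg_left (NonUnitalStarAlgHom.norm_apply_le (τ t) B) (norm_nonneg _)))
    · rw [← mul_sub, mul_comm ‖_‖]
      exact (ω.norm_le _).trans ((norm_mul_le _ _).trans
        (mul_le_mul_of_nonneg_right (NonUnitalStarAlgHom.norm_apply_le (τ t) B) (norm_nonneg _)))
  have closed_right (A : WeylAlg E h) : IsClosed {B : WeylAlg E h |
      IsStripPair b (fun t => ω (A * τ t B)) (fun t => ω (τ t B * A))} := by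
    refine IsSeqClosed.isClosed fun B B₀ hB hlim => ?_
    have hlim' : Tendsto (fun n => ‖A‖ * ‖B₀ - B n‖) atTop (𝓝 0) := by
      have := (tendsto_const_nhds (x := B₀)).sub hlim
      simpa using (this.norm.const_mul ‖A‖)
    refine IsStripPair.of_tendstoUniformly hb hB ?_ ?_
    all_goals
      refine Metric.tendstoUniformly_iff.mpr fun ε hε => ?_
      filter_upwards [hlim'.eventually_lt_const hε] with n hn t
      refine lt_of_le_of_lt ?_ hn
      rw [dist_eq_norm, ← map_sub]
    · rw [← mul_sub, ← map_sub]
      exact (ω.norm_le _).trans ((norm_mul_le _ _).trans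
        (mul_le_mul_of_nonneg_left (NonUnitalStarAlgHom.norm_apply_le (τ t) _) (norm_nonneg _)))
    · rw [← sub_mul, ← map_sub, mul_comm ‖_‖]
      exact (ω.norm_le _).trans ((norm_mul_le _ _).trans
        (mul_le_mul_of_nonneg_right (NonUnitalStarAlgHom.norm_apply_le (τ t) _) (norm_nonneg _)))
  intro A B
  change IsStripPair b (fun t => ω (A * τ t B)) (fun t => ω (τ t B * A))
  induction A using Completion.induction_on with
  | hp => exact closed_left B
  | ih A =>
    induction B using Completion.induction_on with
    | hp => exact closed_right A
    | ih B =>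
      induction A using WeylPre.induction with
      | zero => simpa only [Completion.coe_zero, map_zero, mul_zero, zero_mul] using IsStripPair.zero
      | add x y hx hy =>
        simpa only [Completion.coe_add, add_mul, mul_add, map_add] using hx.add hy
      | W x f =>
        induction B using WeylPre.induction with
        | zero => simpa only [Completion.coe_zero, map_zero, mul_zero, zero_mul] using IsStripPair.zero
        | add x y hx hy =>
          simpa only [Completion.coe_add, add_mul, mul_add, map_add] using hx.add hy
        | W y g =>
          have := (hW f g).const_mul (x * y)
          simpa only [Completion.coe_smul, smul_mul_assoc, mul_smul_comm, map_smul, smul_eq_mul,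
            weyl, ← mul_assoc, mul_comm y x] using this

end WeylState

/-! ### Gaussian curves in Hilbert spaces -/

/-- The Gram kernel of the difference quotients of a curve with Gaussian Gram kernel. -/
lemma inner_slope_of_gaussian {H : Type*} [NormedAddCommGroup H] [InnerProductSpace ℂ H]
    {v : ℝ → H} {Q : ℝ} {φ : ℝ → ℝ} (hφ : ∀ t, φ t = Real.exp (-(t ^ 2 * Q / 2)))
    (hv : ∀ s t, inner ℂ (v s) (v t) = (φ (t - s) : ℂ)) {s t : ℝ} (hs : s ≠ 0) (ht : t ≠ 0) :
    (inner ℂ (slope v 0 s) (slope v 0 t)).re =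
      φ s * φ t * slope (fun x : ℝ => Real.exp (x * Q)) 0 (s * t) + slope φ 0 s * slope φ 0 t := by
  have hφ0 : φ 0 = 1 := by simp [hφ]
  have hφn : φ (-s) = φ s := by simp [hφ]
  have e1 : (inner ℂ (v s - v 0) (v t - v 0)).re = φ (t - s) - φ s - φ t + φ 0 := by
    simp only [inner_sub_left, inner_sub_right, hv, Complex.sub_re, Complex.ofReal_re, sub_zero,
      zero_sub, hφn]
    ring
  -- Splitting the square isolates `exp (s t Q)`; its slope at `0`, taken at the point `s t`, is the
  -- only term that survives in the limit.
  have e2 : φ (t - s) = φ s * φ t * Real.exp (s * t * Q) := by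
    simp only [hφ, ← Real.exp_add]; congr 1; ring
  have e3 : (inner ℂ (slope v 0 s) (slope v 0 t)).re =
      s⁻¹ * (t⁻¹ * (inner ℂ (v s - v 0) (v t - v 0)).re) := by
    simp only [slope, vsub_eq_sub, sub_zero]
    rw [← Complex.coe_smul, ← Complex.coe_smul, inner_smul_left, inner_smul_right,
      Complex.conj_ofReal, Complex.re_ofReal_mul, Complex.re_ofReal_mul]
  rw [e3, e1, e2, hφ0]
  simp only [slope, vsub_eq_sub, sub_zero, smul_eq_mul, zero_mul, Real.exp_zero, hφ0]
  field_simp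
  ring

/-- A curve is differentiable at `0` if the Gram kernel of its difference quotients converges. -/
lemma differentiableAt_of_tendsto_inner_slope {H : Type*} [NormedAddCommGroup H]
    [InnerProductSpace ℂ H] [CompleteSpace H] {v : ℝ → H} {Q : ℝ}
    (hlim : Tendsto (fun p : ℝ × ℝ => (inner ℂ (slope v 0 p.1) (slope v 0 p.2)).re)
      (𝓝[≠] 0 ×ˢ 𝓝[≠] 0) (𝓝 Q)) : DifferentiableAt ℝ v 0 := by
  have hdiag : Tendsto (fun s : ℝ => (inner ℂ (slope v 0 s) (slope v 0 s)).re) (𝓝[≠] 0) (𝓝 Q) := by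
    have h2 : Tendsto (fun s : ℝ => (s, s)) (𝓝[≠] 0) (𝓝[≠] 0 ×ˢ 𝓝[≠] 0) :=
      tendsto_id.prodMk tendsto_id
    have h3 := hlim.comp h2
    simpa only [Function.comp_def] using h3
  -- Expanding the square gives the limit `Q - 2Q + Q = 0`, so the difference quotients are Cauchy
  -- and completeness provides the derivative.
  have hdist : Tendsto (fun p : ℝ × ℝ => ‖slope v 0 p.1 - slope v 0 p.2‖ ^ 2)
      (𝓝[≠] 0 ×ˢ 𝓝[≠] 0) (𝓝 0) := by
    have h1 := ((hdiag.comp tendsto_fst).sub (hlim.const_mul 2)).add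
      (hdiag.comp (tendsto_snd (f := 𝓝[≠] (0 : ℝ))))
    rw [show Q - 2 * Q + Q = 0 by ring] at h1
    refine h1.congr fun p => ?_
    rw [norm_sub_sq (𝕜 := ℂ), norm_sq_eq_re_inner (𝕜 := ℂ) (slope v 0 p.1),
      norm_sq_eq_re_inner (𝕜 := ℂ) (slope v 0 p.2)]
    simp only [RCLike.re_to_complex, Function.comp_apply]
  have hcau : Cauchy (map (slope v 0) (𝓝[≠] 0)) := by
    rw [cauchy_map_iff]
    refine ⟨inferInstance, tendsto_uniformity_iff_dist_tendsto_zero.mpr ?_⟩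
    have := hdist.sqrt
    simpa [Real.sqrt_sq, dist_eq_norm] using this
  obtain ⟨d, hd⟩ := cauchy_map_iff_exists_tendsto.mp hcau
  exact (hasDerivAt_iff_tendsto_slope.mpr hd).differentiableAt

/-- A curve in a Hilbert space whose Gram kernel is Gaussian is differentiable. -/
lemma differentiableAt_of_gaussian {H : Type*} [NormedAddCommGroup H] [InnerProductSpace ℂ H]
    [CompleteSpace H] {v : ℝ → H} {Q : ℝ}
    (hv : ∀ s t, inner ℂ (v s) (v t) = (Real.exp (-((t - s) ^ 2 * Q / 2)) : ℂ)) :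
    DifferentiableAt ℝ v 0 := by
  obtain ⟨φ, hφ⟩ : ∃ φ : ℝ → ℝ, ∀ t, φ t = Real.exp (-(t ^ 2 * Q / 2)) := ⟨_, fun _ => rfl⟩
  have hφ0 : φ 0 = 1 := by simp [hφ]
  have hφd : HasDerivAt φ 0 0 := by
    have h1 : HasDerivAt (fun t : ℝ => -(t ^ 2 * Q / 2)) 0 0 := by
      have h2 := (((hasDerivAt_pow 2 (0 : ℝ)).mul_const Q).div_const 2).neg
      exact h2.congr_deriv (by simp)
    rw [funext hφ]
    exact h1.exp.congr_deriv (by simp)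
  have hφc : Tendsto φ (𝓝[≠] 0) (𝓝 1) := by
    have := hφd.continuousAt.tendsto.mono_left (nhdsWithin_le_nhds (s := {0}ᶜ))
    rwa [hφ0] at this
  have hφs : Tendsto (slope φ 0) (𝓝[≠] 0) (𝓝 0) := hasDerivAt_iff_tendsto_slope.mp hφd
  have hes : Tendsto (slope (fun x : ℝ => Real.exp (x * Q)) 0) (𝓝[≠] 0) (𝓝 Q) := by
    refine hasDerivAt_iff_tendsto_slope.mp ?_
    simpa using ((hasDerivAt_id (0 : ℝ)).mul_const Q).exp
  have hne : ∀ᶠ p : ℝ × ℝ in 𝓝[≠] 0 ×ˢ 𝓝[≠] 0, p.1 ≠ 0 ∧ p.2 ≠ 0 :=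
    (eventually_mem_nhdsWithin (a := (0 : ℝ)) (s := {0}ᶜ)).prod_mk eventually_mem_nhdsWithin
  -- The product `s t` must tend to `0` through nonzero values for the slope of `exp (x Q)` at `s t`
  -- to converge to `Q`.
  have hmul : Tendsto (fun p : ℝ × ℝ => p.1 * p.2) (𝓝[≠] 0 ×ˢ 𝓝[≠] 0) (𝓝[≠] 0) := by
    refine tendsto_nhdsWithin_iff.mpr ⟨?_, hne.mono fun p hp => mul_ne_zero hp.1 hp.2⟩
    have h0 : Tendsto (fun x : ℝ => x) (𝓝[≠] 0) (𝓝 0) := nhdsWithin_le_nhds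
    simpa using (h0.comp tendsto_fst).mul (h0.comp tendsto_snd)
  refine differentiableAt_of_tendsto_inner_slope (Q := Q) ?_
  have h1 := (((hφc.comp tendsto_fst).mul (hφc.comp tendsto_snd)).mul (hes.comp hmul)).add
    ((hφs.comp tendsto_fst).mul (hφs.comp (tendsto_snd (f := 𝓝[≠] (0 : ℝ)))))
  simp only [one_mul, mul_zero, add_zero] at h1
  refine h1.congr' ?_
  filter_upwards [hne] with p hp
  refine (inner_slope_of_gaussian hφ (fun s t => ?_) hp.1 hp.2).symm
  rw [hv, hφ]

/-- The Gram kernel depends only on `t - s`, so a translated curve satisfies the same hypothesis,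
and differentiability at `0` gives continuity at every point. -/
lemma continuous_of_gaussian {H : Type*} [NormedAddCommGroup H] [InnerProductSpace ℂ H]
    [CompleteSpace H] {v : ℝ → H} {Q : ℝ}
    (hv : ∀ s t, inner ℂ (v s) (v t) = (Real.exp (-((t - s) ^ 2 * Q / 2)) : ℂ)) :
    Continuous v := by
  refine continuous_iff_continuousAt.mpr fun s => ?_
  have h1 : DifferentiableAt ℝ (fun t => v (t + s)) 0 :=
    differentiableAt_of_gaussian (Q := Q) fun a b => by rw [hv]; congr 4; ring
  have h2 : ContinuousAt ((fun t => v (t + s)) ∘ fun t => t - s) s := by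
    refine ContinuousAt.comp ?_ (by fun_prop)
    rw [sub_self]; exact h1.continuousAt
  simpa [Function.comp_def] using h2

/-! ### The GNS representation of a classical quasi-free state -/

namespace WeylState

variable (ω : WeylState E h)

/-- The vector `π(a) Ω` of the GNS space. -/
def gnsVec (a : WeylAlg E h) : ω.toPLM.GNS := ((ω.toPLM.toPreGNS a : ω.toPLM.PreGNS) : ω.toPLM.GNS)

lemma inner_gnsVec (a b : WeylAlg E h) : inner ℂ (ω.gnsVec a) (ω.gnsVec b) = ω (star a * b) := by
  rw [gnsVec, gnsVec, Completion.inner_coe]; rfl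

lemma gns_gnsVec (a b : WeylAlg E h) :
    ω.toPLM.gnsStarAlgHom a (ω.gnsVec b) = ω.gnsVec (a * b) := by
  exact PositiveLinearMap.gnsNonUnitalStarAlgHom_apply_coe ω.toPLM

lemma gnsVec_add (a b : WeylAlg E h) : ω.gnsVec (a + b) = ω.gnsVec a + ω.gnsVec b := by
  rw [gnsVec, map_add, Completion.coe_add]; rfl

lemma gnsVec_smul (c : ℂ) (a : WeylAlg E h) : ω.gnsVec (c • a) = c • ω.gnsVec a := by
  rw [gnsVec, map_smul, Completion.coe_smul]; rfl

lemma norm_gnsVec_le (a : WeylAlg E h) : ‖ω.gnsVec a‖ ≤ ‖a‖ := by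
  have h1 : ‖ω.gnsVec a‖ ^ 2 ≤ ‖a‖ ^ 2 := by
    rw [norm_sq_eq_re_inner (𝕜 := ℂ), inner_gnsVec, sq, ← CStarRing.norm_star_mul_self]
    exact (Complex.re_le_norm _).trans (ω.norm_le _)
  exact (sq_le_sq₀ (norm_nonneg _) (norm_nonneg _)).mp h1

lemma continuous_gnsVec : Continuous ω.gnsVec := by
  refine LipschitzWith.continuous (K := 1) (LipschitzWith.of_dist_le_mul fun a b => ?_)
  rw [NNReal.coe_one, one_mul, dist_eq_norm, dist_eq_norm, sub_eq_add_neg a b,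
    show ω.gnsVec a - ω.gnsVec b = ω.gnsVec (a + -b) by
      rw [gnsVec_add, ← neg_one_smul ℂ b, gnsVec_smul, neg_one_smul, sub_eq_add_neg]]
  exact ω.norm_gnsVec_le _

lemma norm_weyl_le (f : E) : ‖weyl h f‖ ≤ 1 := by
  rw [weyl, Completion.norm_coe]
  exact norm_le_of fun ω => (ω.sn_W f).le

/-- The operators `π(W(tf))` have norm at most one for all `t`, so orbits of nearby vectors are
uniformly close. Regularity can therefore be tested on a dense set of vectors. -/
lemma isClosed_continuous_gns (f : E) : IsClosed {ξ : ω.toPLM.GNS |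
    Continuous fun t : ℝ => ω.toPLM.gnsStarAlgHom (weyl h (t • f)) ξ} := by
  refine IsSeqClosed.isClosed fun ξ ξ₀ hξ hlim => ?_
  have hu : TendstoUniformly (fun n (t : ℝ) => ω.toPLM.gnsStarAlgHom (weyl h (t • f)) (ξ n))
      (fun t => ω.toPLM.gnsStarAlgHom (weyl h (t • f)) ξ₀) atTop := by
    refine Metric.tendstoUniformly_iff.mpr fun ε hε => ?_
    have h1 := (tendsto_const_nhds (x := ξ₀)).sub hlim
    rw [sub_self] at h1
    have h2 := h1.norm
    rw [norm_zero] at h2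
    filter_upwards [h2.eventually_lt_const hε] with n hn t
    refine lt_of_le_of_lt ?_ hn
    rw [dist_eq_norm, ← map_sub]
    refine (ContinuousLinearMap.le_opNorm _ _).trans ?_
    refine mul_le_of_le_one_left (norm_nonneg _) ?_
    exact (NonUnitalStarAlgHom.norm_apply_le ω.toPLM.gnsStarAlgHom _).trans (norm_weyl_le _)
  exact hu.continuous (Frequently.of_forall hξ)

end WeylState

namespace Covariance

variable (K : Covariance E 0)

lemma gen_smul (t : ℝ) (f : E) : K.gen (t • f) = (Real.exp (-(t ^ 2 * (K f f).re / 2)) : ℂ) := by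
  rw [gen, K.smul_left, K.smul_right, Complex.ofReal_exp]
  congr 1; push_cast; rw [← K.self_eq_re]; ring

/-- At `h = 0` there is no phase and `g` cancels, leaving `gen ((t - s) • f)`: the orbit of each
Weyl vector is a curve with Gaussian Gram kernel. -/
lemma inner_gnsVec_weyl (f g : E) (s t : ℝ) :
    inner ℂ (K.state.gnsVec (weyl 0 (s • f + g))) (K.state.gnsVec (weyl 0 (t • f + g))) =
      (Real.exp (-((t - s) ^ 2 * (K f f).re / 2)) : ℂ) := by
  rw [WeylState.inner_gnsVec, star_weyl, weyl_mul_weyl, phase_zero, one_smul, K.state_weyl,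
    ← K.gen_smul]
  congr 1
  rw [sub_smul]; abel

lemma isC2 : K.state.IsC2 := by
  refine ⟨fun f ξ => ?_, fun f => ?_⟩
  · induction ξ using Completion.induction_on with
    | hp => exact K.state.isClosed_continuous_gns f
    | ih ξ =>
      obtain ⟨b, rfl⟩ := K.state.toPLM.toPreGNS.surjective ξ
      change Continuous fun t : ℝ => K.state.toPLM.gnsStarAlgHom (weyl 0 (t • f)) (K.state.gnsVec b)
      induction b using Completion.induction_on with
      | hp => exact (K.state.isClosed_continuous_gns f).preimage K.state.continuous_gnsVec
      | ih b =>
        simp only [WeylState.gns_gnsVec]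
        induction b using WeylPre.induction with
        | zero => simp only [Completion.coe_zero, mul_zero]; exact continuous_const
        | add x y hx hy =>
          simp only [Completion.coe_add, mul_add, WeylState.gnsVec_add]
          exact hx.add hy
        | W x g =>
          simp only [Completion.coe_smul, mul_smul_comm, WeylState.gnsVec_smul]
          refine Continuous.const_smul ?_ x
          -- By closedness and linearity only Weyl vectors remain, and `W(tf)` moves `W(g)Ω` along
          -- `t ↦ W(tf + g)Ω`.
          have := continuous_of_gaussian (K.inner_gnsVec_weyl f g)
          refine this.congr fun t => ?_
          rw [← one_smul ℂ (weyl 0 (t • f + g)), ← phase_zero (t • f) g, ← weyl_mul_weyl]; rfl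
  · have := differentiableAt_of_gaussian (K.inner_gnsVec_weyl f 0)
    refine this.congr_of_eventuallyEq (Eventually.of_forall fun t => ?_)
    change K.state.toPLM.gnsStarAlgHom (weyl 0 (t • f)) (K.state.gnsVec 1) = _
    simp only [WeylState.gns_gnsVec, mul_one, add_zero]

/-! ### The weak KMS condition -/

/-- At `h = 0` the kernel `K` is symmetric, so the exponent at `g + t f` is a quadratic polynomial
in `t` with linear coefficient `-K(f, g)`; the prefactor `-i` turns the sign. -/
lemma fieldExp (f g : E) : K.state.fieldExp f g = Complex.I * (K f g * K.gen g) := by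
  have hsym : K g f = K f g := by
    have := K.sub_swap g f
    simpa [sub_eq_zero] using this
  have hd : HasDerivAt (fun t : ℝ => K.state (weyl 0 (g + t • f))) (-(K f g) * K.gen g) 0 := by
    have e : (fun t : ℝ => K.state (weyl 0 (g + t • f))) = fun t : ℝ =>
        Complex.exp (-((K g g + 2 * K f g * t + K f f * t ^ 2) / 2)) := by
      ext t
      rw [K.state_weyl, gen]
      simp only [K.add_left, K.add_right, K.smul_left, K.smul_right, hsym]
      congr 1; ring
    have h1 : HasDerivAt (fun t : ℝ => (t : ℂ)) 1 0 := Complex.ofRealCLM.hasDerivAt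
    have h2 : HasDerivAt (fun t : ℝ => (t : ℂ) ^ 2) 0 0 := (h1.pow 2).congr_deriv (by simp)
    have h3 := ((((h1.const_mul (2 * K f g)).const_add (K g g)).add
      (h2.const_mul (K f f))).div_const 2).neg.cexp
    rw [e]
    refine h3.congr_deriv ?_
    simp [gen]; ring
  rw [WeylState.fieldExp, hd.deriv]; ring

end Covariance

/-! ### Linearity of field expectations -/

namespace WeylState.HasFieldExpectation

variable {ω : WeylState E 0} {Ψ Ψ' : C(WeakDual ℝ E, ℂ)} {z z' : ℂ}

lemma zero : ω.HasFieldExpectation 0 0 := ⟨0, Fin.elim0, Fin.elim0, Fin.elim0, by simp, by simp⟩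

lemma add (h : ω.HasFieldExpectation Ψ z) (h' : ω.HasFieldExpectation Ψ' z') :
    ω.HasFieldExpectation (Ψ + Ψ') (z + z') := by
  obtain ⟨n, c, f, g, rfl, rfl⟩ := h
  obtain ⟨n', c', f', g', rfl, rfl⟩ := h'
  refine ⟨n + n', Fin.append c c', Fin.append f f', Fin.append g g', ?_, ?_⟩ <;>
    simp [Fin.sum_univ_add]

lemma smul (a : ℂ) (h : ω.HasFieldExpectation Ψ z) : ω.HasFieldExpectation (a • Ψ) (a * z) := by
  obtain ⟨n, c, f, g, rfl, rfl⟩ := h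
  exact ⟨n, fun i => a * c i, f, g, by simp [Finset.smul_sum, smul_smul], by
    simp [Finset.mul_sum, mul_assoc]⟩

lemma field_mul (f g : E) : ω.HasFieldExpectation (field f * ev (W 0 g)) (ω.fieldExp f g) :=
  ⟨1, fun _ => 1, fun _ => f, fun _ => g, by simp, by simp⟩

end WeylState.HasFieldExpectation

/-- The weak KMS condition for the derivation of an operator `L` with `β K(L f, g) = σ(f, g)`. -/
lemma Covariance.weakKMS (K : Covariance E 0) (L : E →ₗ[ℝ] E) (β : ℝ)
    (hL : ∀ f g, β * K (L f) g = symp f g) (a b : WeylPre E 0) :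
    ∃ z : ℂ, K.state.HasFieldExpectation (ev b * WeakDerivation.ofOperatorL L a) z ∧
      K.state (poisson a b : WeylPre E 0) = β * z := by
  induction a using WeylPre.induction with
  | zero => exact ⟨0, by simpa using .zero, by simp [Completion.coe_zero]⟩
  | add a a' ha ha' =>
    obtain ⟨z, h1, h2⟩ := ha
    obtain ⟨z', h1', h2'⟩ := ha'
    refine ⟨z + z', by simpa only [map_add, mul_add] using h1.add h1', ?_⟩
    rw [map_add, LinearMap.add_apply, Completion.coe_add, map_add, h2, h2', mul_add]
  | W x f =>
    induction b using WeylPre.induction with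
    | zero => exact ⟨0, by simpa using .zero, by simp [Completion.coe_zero]⟩
    | add b b' hb hb' =>
      obtain ⟨z, h1, h2⟩ := hb
      obtain ⟨z', h1', h2'⟩ := hb'
      refine ⟨z + z', by simpa only [map_add, add_mul] using h1.add h1', ?_⟩
      rw [map_add, Completion.coe_add, map_add, h2, h2', mul_add]
    | W y g =>
      -- For Weyl elements `b δ(a)` is a multiple of the single product `Φ_0(L f) W^0(f + g)`, the
      -- `i` coming from the derivation.
      refine ⟨x * y * Complex.I * K.state.fieldExp (L f) (f + g), ?_, ?_⟩
      · convert! (WeylState.HasFieldExpectation.field_mul (ω := K.state) (L f) (f + g)).smul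
          (x * y * Complex.I) using 1
        rw [map_smul, map_smul, WeakDerivation.ofOperatorL_W]
        ext F
        simp [ev_W, expField_add]
        ring
      · have hp : poisson (W 0 f) (W 0 g) = (symp g f : ℂ) • W 0 (f + g) := by
          rw [poisson, ← basis_apply, ← basis_apply, Module.Basis.constr_basis,
            Module.Basis.constr_basis]
        -- The contribution of `f` drops out because `σ(f, f) = 0`. The two factors `i`, from the
        -- derivation and from `fieldExp`, give the sign in `σ(g, f) = -σ(f, g)`.
        have hs : β * K (L f) (f + g) = symp f g := by
          rw [hL, symp_add_right, symp_self, zero_add]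
        rw [map_smul, map_smul, LinearMap.smul_apply, hp, Completion.coe_smul, Completion.coe_smul,
          Completion.coe_smul, map_smul, map_smul, map_smul, K.fieldExp, symp_swap]
        have := K.state_weyl (f + g)
        rw [weyl] at this
        rw [this]
        simp only [smul_eq_mul, Complex.ofReal_neg]
        rw [← hs]
        linear_combination (-(x * y * β * K (L f) (f + g) * K.gen (f + g))) * Complex.I_sq

end FreeBose

end

noncomputable section

namespace FreeBose

open MeasureTheory TestSpace
open scoped SchwartzMap FourierTransform Laplacian

/-! ### Laplace-Fourier integrals -/

section LaplaceFourier

variable {α : Type*} [MeasurableSpace α] {μ : Measure α} {e : α → ℝ} {p : α → ℂ}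

/-- The modulus of `exp (i z e)` is `exp (-e Im z)`, at most `1` when `e ≥ 0` and `Im z ≥ 0`. This
is the domination behind continuity, holomorphy and boundedness of the integrals below. -/
lemma norm_cexp_mul_le (he : ∀ a, 0 ≤ e a) {z : ℂ} (hz : 0 ≤ z.im) (a : α) :
    ‖Complex.exp (Complex.I * z * e a) * p a‖ ≤ ‖p a‖ := by
  rw [norm_mul, Complex.norm_exp]
  refine mul_le_of_le_one_left (norm_nonneg _) (Real.exp_le_one_iff.mpr ?_)
  simpa using mul_nonneg hz (he a)

lemma aestronglyMeasurable_cexp_mul (hm : Measurable e) (hp : AEStronglyMeasurable p μ) (z : ℂ) :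
    AEStronglyMeasurable (fun a => Complex.exp (Complex.I * z * e a) * p a) μ := by
  have : Measurable fun a => Complex.exp (Complex.I * z * e a) := by fun_prop
  exact this.aestronglyMeasurable.mul hp

lemma continuousOn_integral_cexp (hm : Measurable e) (he : ∀ a, 0 ≤ e a) (hp : Integrable p μ) :
    ContinuousOn (fun z : ℂ => ∫ a, Complex.exp (Complex.I * z * e a) * p a ∂μ)
      {z | 0 ≤ z.im} := by
  refine continuousOn_of_dominated (bound := fun a => ‖p a‖) (fun z _ =>
    aestronglyMeasurable_cexp_mul hm hp.1 z) (fun z hz => ?_) hp.norm ?_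
  · exact Eventually.of_forall fun a => norm_cexp_mul_le he hz a
  · exact Eventually.of_forall fun a => by fun_prop

lemma differentiableOn_integral_cexp (hm : Measurable e) (he : ∀ a, 0 ≤ e a) (hp : Integrable p μ)
    (hep : Integrable (fun a => e a * p a) μ) :
    DifferentiableOn ℂ (fun z : ℂ => ∫ a, Complex.exp (Complex.I * z * e a) * p a ∂μ)
      {z | 0 < z.im} := by
  intro z hz
  have hs : {z : ℂ | 0 < z.im} ∈ 𝓝 z :=
    (isOpen_lt continuous_const Complex.continuous_im).mem_nhds hz
  refine (hasDerivAt_integral_of_dominated_loc_of_deriv_le (bound := fun a => ‖e a * p a‖)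
    (F' := fun z a => Complex.exp (Complex.I * z * e a) * (Complex.I * (e a * p a))) hs
    (Eventually.of_forall fun z => aestronglyMeasurable_cexp_mul hm hp.1 z)
    (hp.mono (aestronglyMeasurable_cexp_mul hm hp.1 z)
      (Eventually.of_forall fun a => norm_cexp_mul_le he (le_of_lt hz) a))
    (aestronglyMeasurable_cexp_mul hm (hep.1.const_mul Complex.I) z) ?_ hep.norm
    ?_).2.differentiableAt.differentiableWithinAt
  · refine Eventually.of_forall fun a w hw => ?_
    refine (norm_cexp_mul_le (p := fun a => Complex.I * (e a * p a)) he (le_of_lt hw) a).trans ?_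
    simp
  · refine Eventually.of_forall fun a w _ => ?_
    have h1 : HasDerivAt (fun z : ℂ => Complex.I * z * e a) (Complex.I * e a) w := by
      simpa using ((hasDerivAt_id w).const_mul Complex.I).mul_const (e a : ℂ)
    exact (h1.cexp.mul_const (p a)).congr_deriv (by ring)

lemma norm_integral_cexp_le (hm : Measurable e) (he : ∀ a, 0 ≤ e a) (hp : Integrable p μ)
    {z : ℂ} (hz : 0 ≤ z.im) :
    ‖∫ a, Complex.exp (Complex.I * z * e a) * p a ∂μ‖ ≤ ∫ a, ‖p a‖ ∂μ :=
  (norm_integral_le_integral_norm _).trans (integral_mono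
    (hp.mono (aestronglyMeasurable_cexp_mul hm hp.1 z)
      (Eventually.of_forall fun a => norm_cexp_mul_le he hz a)).norm hp.norm
    fun a => norm_cexp_mul_le he hz a)

end LaplaceFourier

/-! ### The test functions in Fourier space -/

variable {ν : ℕ}

namespace TestSpace

/-- The Fourier transform of a test function. -/
def hat (f : TestSpace ν) : 𝓢(EuclideanSpace ℝ (Fin ν), ℂ) := 𝓕 (toSchwartz f)

lemma hat_add (f g : TestSpace ν) (ξ : EuclideanSpace ℝ (Fin ν)) :
    hat (f + g) ξ = hat f ξ + hat g ξ := by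
  simp [hat, FourierTransform.fourier_add]

lemma hat_smul (c : ℂ) (f : TestSpace ν) (ξ : EuclideanSpace ℝ (Fin ν)) :
    hat (c • f) ξ = c * hat f ξ := by
  simp [hat, FourierTransform.fourier_smul]

lemma inner_eq_integral_hat (f g : TestSpace ν) :
    inner ℂ f g = ∫ ξ, conj (hat f ξ) * hat g ξ := by
  rw [TestSpace.inner_eq]
  have := SchwartzMap.integral_inner_fourier_fourier (toSchwartz f) (toSchwartz g)
  simp only [RCLike.inner_apply'] at this
  exact this.symm

/-- The condensate is the zero momentum mode; since `energy 0 = 0`, the Hamiltonian annihilates it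
and the evolution fixes it. -/
lemma total_eq_hat (f : TestSpace ν) : total f = hat f 0 := by
  rw [hat, SchwartzMap.fourier_coe, Real.fourier_eq, total]
  simp

lemma hat_hamiltonian (f : TestSpace ν) (ξ : EuclideanSpace ℝ (Fin ν)) :
    hat (hamiltonian f) ξ = energy ξ * hat f ξ := by
  have h1 : toSchwartz (hamiltonian f) = (-(1 / 2) : ℂ) • Δ (toSchwartz f) := rfl
  rw [hat, h1, SchwartzMap.laplacian_eq_fourierMultiplierCLM,
    SchwartzMap.fourierMultiplierCLM_apply, FourierTransform.fourier_smul,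
    FourierTransform.fourier_smul, FourierTransform.fourier_fourierInv_eq, _root_.smul_apply,
    _root_.smul_apply, SchwartzMap.smulLeftCLM_apply_apply (by fun_prop), ← hat]
  simp [energy]
  ring

lemma hat_freeEvolution (t : ℝ) (f : TestSpace ν) (ξ : EuclideanSpace ℝ (Fin ν)) :
    hat (freeEvolution t f) ξ = Complex.exp (Complex.I * t * energy ξ) * hat f ξ := by
  have h1 : toSchwartz (freeEvolution t f) =
    SchwartzMap.fourierMultiplierCLM ℂ (fun ξ : EuclideanSpace ℝ (Fin ν) =>
      Complex.exp (Complex.I * (t * energy ξ : ℝ))) (toSchwartz f) := rfl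
  rw [hat, h1, SchwartzMap.fourierMultiplierCLM_apply, FourierTransform.fourier_fourierInv_eq,
    SchwartzMap.smulLeftCLM_apply_apply (temperate_energy t), ← hat]
  simp [mul_assoc]

lemma total_hamiltonian (f : TestSpace ν) : total (hamiltonian f) = 0 := by
  rw [total_eq_hat, hat_hamiltonian]; simp [energy]

lemma total_freeEvolution (t : ℝ) (f : TestSpace ν) : total (freeEvolution t f) = total f := by
  rw [total_eq_hat, hat_freeEvolution, total_eq_hat]; simp [energy]

lemma total_add (f g : TestSpace ν) : total (f + g) = total f + total g := by
  simp only [total_eq_hat, hat_add]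

lemma total_smul (c : ℂ) (f : TestSpace ν) : total (c • f) = c * total f := by
  simp only [total_eq_hat, hat_smul]

/-- A bump function equal to `1` at the origin is the Fourier transform of a Schwartz function. Such
a test function distinguishes the condensate densities. -/
lemma exists_total_ne_zero : ∃ f : TestSpace ν, total f ≠ 0 := by
  let b : ContDiffBump (0 : EuclideanSpace ℝ (Fin ν)) := default
  have hs : HasCompactSupport fun x => (b x : ℂ) :=
    b.hasCompactSupport.comp_left (g := fun y : ℝ => (y : ℂ)) (by simp)
  have hc : ContDiff ℝ (⊤ : ℕ∞) fun x => (b x : ℂ) :=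
    Complex.ofRealCLM.contDiff.comp b.contDiff
  refine ⟨toSchwartz.symm (𝓕⁻ (hs.toSchwartzMap hc)), ?_⟩
  rw [total_eq_hat, hat, LinearEquiv.apply_symm_apply, FourierTransform.fourier_fourierInv_eq]
  have : b 0 = 1 := b.one_of_mem_closedBall (by simpa using b.rIn_pos.le)
  simp [this]

end TestSpace

lemma energy_nonneg (ξ : EuclideanSpace ℝ (Fin ν)) : 0 ≤ energy ξ := by
  unfold energy; positivity

lemma measurable_energy : Measurable (energy : EuclideanSpace ℝ (Fin ν) → ℝ) := by
  unfold energy; fun_prop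

lemma energy_pos {ξ : EuclideanSpace ℝ (Fin ν)} (hξ : ξ ≠ 0) : 0 < energy ξ := by
  have := norm_pos_iff.mpr hξ
  have := Real.pi_pos
  unfold energy; positivity

/-! ### Weights with an infrared singularity -/

/-- The function `‖ξ‖⁻²` is integrable near the origin in dimension at least three. -/
lemma integrableOn_inv_norm_sq (hν : 3 ≤ ν) :
    IntegrableOn (fun ξ : EuclideanSpace ℝ (Fin ν) => (‖ξ‖ ^ 2)⁻¹) (Metric.ball 0 1) := by
  have : Nontrivial (EuclideanSpace ℝ (Fin ν)) := by
    have : Nonempty (Fin ν) := ⟨⟨0, by omega⟩⟩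
    infer_instance
  -- In polar coordinates the radial density is `y^(ν - 1) y^(-2) = y^(ν - 3)`, with a nonnegative
  -- exponent.
  refine (integrableOn_fun_norm_addHaar volume (f := fun y => (y ^ 2)⁻¹)).mpr ?_
  rw [finrank_euclideanSpace, Fintype.card_fin]
  have h1 : IntegrableOn (fun y : ℝ => y ^ (ν - 3)) (Set.Ioo 0 1) :=
    ((continuous_pow (ν - 3)).integrableOn_Icc).mono_set Set.Ioo_subset_Icc_self
  refine h1.congr_fun (fun y hy => ?_) measurableSet_Ioo
  have hy0 : y ≠ 0 := hy.1.ne'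
  obtain ⟨k, rfl⟩ : ∃ k, ν = k + 3 := ⟨ν - 3, by omega⟩
  simp only [smul_eq_mul, Nat.add_sub_cancel, show k + 3 - 1 = k + 2 by omega]
  field_simp
  ring

/-- Nonnegative measurable functions bounded by a multiple of `1 + 1/H` in Fourier space. -/
structure IsWeight (w : EuclideanSpace ℝ (Fin ν) → ℝ) : Prop where
  measurable : Measurable w
  nonneg : ∀ ξ, 0 ≤ w ξ
  bound : ∃ A B : ℝ, 0 ≤ A ∧ 0 ≤ B ∧ ∀ ξ, w ξ ≤ A + B * (energy ξ)⁻¹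

namespace IsWeight

variable {w : EuclideanSpace ℝ (Fin ν) → ℝ}

/-- In the unit ball the Fourier transforms are bounded and `1/energy ≤ ‖ξ‖⁻²` is integrable;
outside it `1/energy ≤ 1`, and the product of two square-integrable functions is integrable. -/
lemma integrable_inv_energy_mul (hν : 3 ≤ ν) (f g : TestSpace ν) :
    Integrable fun ξ => (energy ξ)⁻¹ * ‖conj (hat f ξ) * hat g ξ‖ := by
  obtain ⟨C, hC⟩ : ∃ C, ∀ ξ, ‖conj (hat f ξ) * hat g ξ‖ ≤ C := by
    refine ⟨SchwartzMap.seminorm ℝ 0 0 (hat f) * SchwartzMap.seminorm ℝ 0 0 (hat g), fun ξ => ?_⟩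
    rw [norm_mul, RCLike.norm_conj]
    gcongr
    · exact SchwartzMap.norm_le_seminorm ℝ _ ξ
    · exact SchwartzMap.norm_le_seminorm ℝ _ ξ
  have hp : Integrable fun ξ => ‖conj (hat f ξ) * hat g ξ‖ :=
    (((hat f).memLp 2).star.integrable_mul ((hat g).memLp 2)).norm
  have hm : AEStronglyMeasurable (fun ξ => (energy ξ)⁻¹ * ‖conj (hat f ξ) * hat g ξ‖) :=
    measurable_energy.inv.aestronglyMeasurable.mul hp.1
  have h1 : Integrable (Set.indicator (Metric.ball 0 1)
      fun ξ : EuclideanSpace ℝ (Fin ν) => (‖ξ‖ ^ 2)⁻¹) :=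
    (integrable_indicator_iff Metric.isOpen_ball.measurableSet).mpr (integrableOn_inv_norm_sq hν)
  have hpi : 1 ≤ 2 * Real.pi ^ 2 := by nlinarith [Real.pi_gt_three]
  have he (ξ : EuclideanSpace ℝ (Fin ν)) : (energy ξ)⁻¹ ≤ (‖ξ‖ ^ 2)⁻¹ := by
    rw [energy, mul_inv]
    exact mul_le_of_le_one_left (by positivity) (inv_le_one_of_one_le₀ hpi)
  refine ((h1.const_mul C).add hp).mono' hm (Eventually.of_forall fun ξ => ?_)
  have hi := inv_nonneg.mpr (energy_nonneg ξ)
  have hq := norm_nonneg (conj (hat f ξ) * hat g ξ)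
  rw [Real.norm_of_nonneg (mul_nonneg hi hq)]
  by_cases hξ : ξ ∈ Metric.ball 0 1
  · simp only [Pi.add_apply, Set.indicator_of_mem hξ]
    rw [mul_comm]
    exact (mul_le_mul (hC ξ) (he ξ) hi (hq.trans (hC ξ))).trans (le_add_of_nonneg_right hq)
  · simp only [Pi.add_apply, Set.indicator_of_notMem hξ, mul_zero, zero_add]
    refine mul_le_of_le_one_left hq ((he ξ).trans (inv_le_one_of_one_le₀ ?_))
    have : 1 ≤ ‖ξ‖ := by simpa using hξ
    nlinarith

lemma integrable (h : IsWeight w) (hν : 3 ≤ ν) (f g : TestSpace ν) :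
    Integrable fun ξ => (w ξ : ℂ) * (conj (hat f ξ) * hat g ξ) := by
  obtain ⟨A, B, hA, hB, hw⟩ := h.bound
  have hp : Integrable fun ξ => conj (hat f ξ) * hat g ξ :=
    ((hat f).memLp 2).star.integrable_mul ((hat g).memLp 2)
  refine ((hp.norm.const_mul A).add ((integrable_inv_energy_mul hν f g).const_mul B)).mono'
    ((Complex.measurable_ofReal.comp h.measurable).aestronglyMeasurable.mul hp.1)
    (Eventually.of_forall fun ξ => ?_)
  rw [norm_mul, Complex.norm_real, Real.norm_of_nonneg (h.nonneg ξ)]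
  refine (mul_le_mul_of_nonneg_right (hw ξ) (norm_nonneg _)).trans_eq ?_
  simp only [Pi.add_apply]; ring

end IsWeight

/-! ### Elementary bounds on the Bose factor -/

lemma one_sub_exp_neg_pos {x : ℝ} (hx : 0 < x) : 0 < 1 - Real.exp (-x) :=
  sub_pos.mpr (Real.exp_lt_one_iff.mpr (neg_lt_zero.mpr hx))

/-- For `x > 0` this is a rearrangement of `1 + x ≤ exp x`; at `x = 0` both inverses are `0` by
convention. It bounds the Bose distribution by its classical infrared singularity. -/
lemma inv_one_sub_exp_neg_le {x : ℝ} (hx : 0 ≤ x) : (1 - Real.exp (-x))⁻¹ ≤ 1 + x⁻¹ := by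
  rcases hx.eq_or_lt with rfl | hx
  · simp
  · have h1 := Real.add_one_le_exp x
    have h2 := one_sub_exp_neg_pos hx
    rw [inv_le_iff_one_le_mul₀ h2, Real.exp_neg]
    have h3 := Real.exp_pos x
    have e : (1 + x⁻¹) * (1 - (Real.exp x)⁻¹) - 1 =
        (Real.exp x - 1 - x) / (x * Real.exp x) := by
      field_simp; ring
    have : 0 ≤ (Real.exp x - 1 - x) / (x * Real.exp x) := div_nonneg (by linarith) (by positivity)
    linarith

end FreeBose

end

noncomputable section

namespace FreeBose

open MeasureTheory TestSpace
open scoped SchwartzMap FourierTransform Laplacian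

/-! ### Hermitian kernels -/

section Kernels

variable {E : Type*} [AddCommGroup E] [Module ℂ E]

/-- A positive semidefinite sesquilinear form has positive semidefinite Gram matrices. -/
lemma posSemidef_of_sesq (B : E →ₗ⋆[ℂ] E →ₗ[ℂ] ℂ) (hB : ∀ f g, conj (B f g) = B g f)
    (h0 : ∀ f, 0 ≤ B f f) : (Matrix.of fun f g => B f g : Matrix E E ℂ).PosSemidef := by
  refine ⟨by ext f g; exact hB g f, fun x => ?_⟩
  refine (h0 (x.sum fun f c => c • f)).trans_eq ?_
  simp only [Finsupp.sum, map_sum, LinearMap.sum_apply, map_smulₛₗ, LinearMap.smul_apply,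
    smul_eq_mul, Matrix.of_apply, Finset.mul_sum, RingHom.id_apply]
  rw [Finset.sum_comm]
  refine Finset.sum_congr rfl fun f _ => Finset.sum_congr rfl fun g _ => ?_
  rw [starRingEnd_apply]; ring

end Kernels

variable {ν : ℕ}

/-! ### Covariances of the free gas -/

/-- The form `⟨f, w g⟩` of a multiplication operator in Fourier space. -/
def weightForm (w : EuclideanSpace ℝ (Fin ν) → ℝ) (f g : TestSpace ν) : ℂ :=
  ∫ ξ, (w ξ : ℂ) * (conj (hat f ξ) * hat g ξ)

lemma conj_weightForm (w : EuclideanSpace ℝ (Fin ν) → ℝ) (f g : TestSpace ν) :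
    conj (weightForm w f g) = weightForm w g f := by
  rw [weightForm, ← integral_conj]
  refine integral_congr_ae (Eventually.of_forall fun ξ => ?_)
  simp only [map_mul, Complex.conj_ofReal, Complex.conj_conj]; ring

lemma weightForm_self (w : EuclideanSpace ℝ (Fin ν) → ℝ) (f : TestSpace ν) :
    weightForm w f f = ((∫ ξ, w ξ * ‖hat f ξ‖ ^ 2 : ℝ) : ℂ) := by
  rw [weightForm, ← integral_complex_ofReal]
  refine integral_congr_ae (Eventually.of_forall fun ξ => ?_)
  simp only [Complex.conj_mul']; push_cast; rfl

namespace IsWeight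

variable {w : EuclideanSpace ℝ (Fin ν) → ℝ}

lemma weightForm_add_right (h : IsWeight w) (hν : 3 ≤ ν) (f g k : TestSpace ν) :
    weightForm w f (g + k) = weightForm w f g + weightForm w f k := by
  rw [weightForm, weightForm, weightForm, ← integral_add (h.integrable hν f g)
    (h.integrable hν f k)]
  simp only [hat_add, mul_add]

lemma weightForm_smul_right (w : EuclideanSpace ℝ (Fin ν) → ℝ) (c : ℂ) (f g : TestSpace ν) :
    weightForm w f (c • g) = c * weightForm w f g := by
  rw [weightForm, weightForm, ← integral_const_mul]
  refine integral_congr_ae (Eventually.of_forall fun ξ => ?_)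
  simp only [hat_smul]; ring

/-- The form of a weight as a sesquilinear map. -/
def sesq (h : IsWeight w) (hν : 3 ≤ ν) : TestSpace ν →ₗ⋆[ℂ] TestSpace ν →ₗ[ℂ] ℂ :=
  LinearMap.mk₂'ₛₗ (starRingEnd ℂ) (RingHom.id ℂ) (weightForm w)
    (fun f g k => by
      simp only [← conj_weightForm w k, h.weightForm_add_right hν, map_add])
    (fun c f g => by
      simp only [← conj_weightForm w g, weightForm_smul_right, map_mul, smul_eq_mul])
    (fun f g k => h.weightForm_add_right hν f g k)
    (fun c f g => weightForm_smul_right w c f g)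

lemma posSemidef (h : IsWeight w) (hν : 3 ≤ ν) :
    (Matrix.of (weightForm w) : Matrix (TestSpace ν) (TestSpace ν) ℂ).PosSemidef := by
  refine posSemidef_of_sesq (h.sesq hν) (conj_weightForm w) fun f => ?_
  change 0 ≤ weightForm w f f
  rw [weightForm_self]
  exact Complex.zero_le_real.mpr
    (integral_nonneg fun ξ => mul_nonneg (h.nonneg ξ) (sq_nonneg _))

end IsWeight

/-- The rank-one form of the condensate. -/
def condensateForm : TestSpace ν →ₗ⋆[ℂ] TestSpace ν →ₗ[ℂ] ℂ :=
  LinearMap.mk₂'ₛₗ (starRingEnd ℂ) (RingHom.id ℂ) (fun f g => conj (total f) * total g)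
    (fun f g k => by simp only [total_add, map_add, add_mul])
    (fun c f g => by simp only [total_smul, map_mul, smul_eq_mul]; ring)
    (fun f g k => by simp only [total_add, mul_add])
    (fun c f g => by simp only [total_smul, RingHom.id_apply, smul_eq_mul]; ring)

lemma condensateForm_apply (f g : TestSpace ν) :
    condensateForm f g = conj (total f) * total g := rfl

lemma conj_condensateForm (f g : TestSpace ν) : conj (condensateForm f g) = condensateForm g f := by
  simp only [condensateForm_apply, map_mul, Complex.conj_conj]; ring

lemma posSemidef_condensateForm : (Matrix.of fun f g => condensateForm f g :
    Matrix (TestSpace ν) (TestSpace ν) ℂ).PosSemidef :=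
  posSemidef_of_sesq condensateForm conj_condensateForm fun f => by
    rw [condensateForm_apply, Complex.conj_mul']
    exact_mod_cast sq_nonneg ‖total f‖

/-- Plancherel's identity. The origin is exempt because the convention `0⁻¹ = 0` makes both Bose
weights vanish there; a point is a null set in positive dimension. -/
lemma weightForm_sub_eq_inner {w₁ w₂ : EuclideanSpace ℝ (Fin ν) → ℝ} (hν : 3 ≤ ν)
    (h₁ : IsWeight w₁) (h₂ : IsWeight w₂) {c : ℝ} (hw : ∀ ξ, ξ ≠ 0 → w₁ ξ - w₂ ξ = c)
    (f g : TestSpace ν) : weightForm w₁ f g - weightForm w₂ f g = c * inner ℂ f g := by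
  rw [weightForm, weightForm, ← integral_sub (h₁.integrable hν f g) (h₂.integrable hν f g),
    inner_eq_integral_hat, ← integral_const_mul]
  have : Nonempty (Fin ν) := ⟨⟨0, by omega⟩⟩
  have : Nontrivial (EuclideanSpace ℝ (Fin ν)) := inferInstance
  refine integral_congr_ae ?_
  filter_upwards [Measure.ae_ne volume (0 : EuclideanSpace ℝ (Fin ν))] with ξ hξ
  rw [← sub_mul, ← Complex.ofReal_sub, hw ξ hξ]

/-- The covariance with two-point function `w₁` and `w₂` in Fourier space and condensate
density `c`. -/
def gasCovariance (hν : 3 ≤ ν) (h : ℝ≥0) {w₁ w₂ : EuclideanSpace ℝ (Fin ν) → ℝ}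
    (h₁ : IsWeight w₁) (h₂ : IsWeight w₂) (hw : ∀ ξ, ξ ≠ 0 → w₁ ξ - w₂ ξ = h / 2) (c : ℝ≥0) :
    Covariance (TestSpace ν) h where
  toFun f g := weightForm w₁ f g + weightForm w₂ g f +
    (c / 2 : ℂ) * (condensateForm f g + condensateForm g f)
  posSemidef := by
    have hc : (0 : ℂ) ≤ c / 2 := by
      rw [show (c / 2 : ℂ) = ((c / 2 : ℝ) : ℂ) by push_cast; rfl]
      exact Complex.zero_le_real.mpr (by positivity)
    exact ((h₁.posSemidef hν).add (h₂.posSemidef hν).transpose).add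
      ((posSemidef_condensateForm.add posSemidef_condensateForm.transpose).smul hc)
  add_right f g k := by
    rw [h₁.weightForm_add_right hν, ← conj_weightForm w₂ f (g + k), h₂.weightForm_add_right hν,
      map_add, conj_weightForm, conj_weightForm, map_add, map_add, LinearMap.add_apply]
    ring
  smul_right t f g := by
    rw [← Complex.coe_smul, IsWeight.weightForm_smul_right, ← conj_weightForm w₂ f,
      IsWeight.weightForm_smul_right, map_mul, conj_weightForm, map_smul, map_smulₛₗ,
      LinearMap.smul_apply, Complex.conj_ofReal, smul_eq_mul, smul_eq_mul]
    ring
  sub_swap f g := by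
    -- The condensate term is symmetric and cancels; what remains is `(h/2)(⟨f, g⟩ - ⟨g, f⟩) = i h
    -- σ(f, g)`.
    have e1 := weightForm_sub_eq_inner hν h₁ h₂ hw f g
    have e2 := weightForm_sub_eq_inner hν h₁ h₂ hw g f
    rw [← inner_conj_symm] at e2
    have e3 : inner ℂ f g - conj (inner ℂ f g) = 2 * Complex.I * (symp f g : ℂ) := by
      rw [Complex.sub_conj, symp]; push_cast; ring
    push_cast at e1 e2 ⊢
    linear_combination e1 - e2 + (h / 2 : ℂ) * e3

lemma gasCovariance_apply (hν : 3 ≤ ν) (h : ℝ≥0) {w₁ w₂ : EuclideanSpace ℝ (Fin ν) → ℝ}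
    (h₁ : IsWeight w₁) (h₂ : IsWeight w₂) (hw : ∀ ξ, ξ ≠ 0 → w₁ ξ - w₂ ξ = h / 2) (c : ℝ≥0)
    (f g : TestSpace ν) : gasCovariance hν h h₁ h₂ hw c f g =
      weightForm w₁ f g + weightForm w₂ g f +
        (c / 2 : ℂ) * (condensateForm f g + condensateForm g f) := rfl

/-- The generating function, in terms of the quadratic form of a function `φ(H)`. -/
lemma gasCovariance_gen (hν : 3 ≤ ν) (h : ℝ≥0) {w₁ w₂ : EuclideanSpace ℝ (Fin ν) → ℝ}
    (h₁ : IsWeight w₁) (h₂ : IsWeight w₂) (hw : ∀ ξ, ξ ≠ 0 → w₁ ξ - w₂ ξ = h / 2) (c : ℝ≥0)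
    {a : ℝ} {φ : ℝ → ℝ} (hφ : ∀ ξ : EuclideanSpace ℝ (Fin ν), w₁ ξ + w₂ ξ = a * φ (energy ξ))
    (f : TestSpace ν) : (gasCovariance hν h h₁ h₂ hw c).gen f =
      (Real.exp (-(a * kineticForm φ f + c * ‖total f‖ ^ 2) / 2) : ℂ) := by
  rw [Covariance.gen, gasCovariance_apply, Complex.ofReal_exp]
  have e : weightForm w₁ f f + weightForm w₂ f f = (a * kineticForm φ f : ℝ) := by
    rw [weightForm, weightForm, ← integral_add (h₁.integrable hν f f) (h₂.integrable hν f f),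
      kineticForm, ← integral_const_mul, ← integral_complex_ofReal]
    refine integral_congr_ae (Eventually.of_forall fun ξ => ?_)
    beta_reduce
    rw [← add_mul, ← Complex.ofReal_add, hφ, Complex.conj_mul', hat]
    push_cast; ring
  rw [e, condensateForm_apply, Complex.conj_mul']
  congr 1
  push_cast; ring

end FreeBose

end

noncomputable section

namespace FreeBose

/-! ### Weak derivations of skew-symmetric operators -/

section Derivation

variable {E : Type*} [NormedAddCommGroup E] [InnerProductSpace ℂ E]

/-- The functional `Re ⟨k, ·⟩`. -/
def innerDual (k : E) : WeakDual ℝ E := 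
  StrongDual.toWeakDual (Complex.reCLM ∘L (innerSL ℂ k).restrictScalars ℝ)

lemma innerDual_apply (k f : E) : innerDual k f = (inner ℂ k f).re := rfl

/-- Every functional agrees on a given finite set with an inner product. -/
lemma exists_innerDual_eq (F : WeakDual ℝ E) (s : Finset E) :
    ∃ k : E, ∀ x ∈ s, innerDual k x = F x := by
  let _ := InnerProductSpace.rclikeToReal ℂ E
  -- Riesz representation is applied to the restriction of `F` to the finite-dimensional, hence
  -- complete, real span; `E` itself need not be complete.
  let V : Submodule ℝ E := Submodule.span ℝ (s : Set E)
  have : FiniteDimensional ℝ V := FiniteDimensional.span_finset ℝ s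
  let F' : StrongDual ℝ E := WeakDual.toStrongDual F
  let v : V := (InnerProductSpace.toDual ℝ V).symm (F'.comp V.subtypeL)
  refine ⟨v, fun x hx => ?_⟩
  exact InnerProductSpace.toDual_symm_apply (x := (⟨x, Submodule.subset_span hx⟩ : V))
    (y := F'.comp V.subtypeL)

/-- Weak-* convergence is pointwise convergence, so the representatives of `F` on finite sets,
indexed by those sets, form a net tending to `F`. -/
lemma denseRange_innerDual : DenseRange (innerDual : E → WeakDual ℝ E) := by
  intro F
  choose k hk using exists_innerDual_eq F
  refine mem_closure_of_tendsto (f := fun s : Finset E => innerDual (k s)) (b := atTop) ?_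
    (Eventually.of_forall fun s => ⟨k s, rfl⟩)
  refine (tendsto_iff_forall_eval_tendsto_topDualPairing).mpr fun x => ?_
  refine tendsto_const_nhds.congr' ?_
  filter_upwards [eventually_ge_atTop {x}] with s hs
  exact (hk s x (by simpa using hs)).symm

namespace WeakDerivation

variable (L : E →ₗ[ℝ] E)

lemma ofOperator_W (f : E) (hf : WeylPre.W 0 f ∈ (ofOperator L).domain) (F : WeakDual ℝ E) :
    (ofOperator L).toFun ⟨WeylPre.W 0 f, hf⟩ F =
      Complex.I * ((F (L f) : ℂ) * Complex.exp (Complex.I * (F f : ℂ))) := by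
  change ofOperatorL L (WeylPre.W 0 f) F = _
  rw [ofOperatorL_W, ev_W]
  rfl

lemma ofOperator_isContinuous (hL : ∀ f : E, Continuous fun c : ℂ => L (c • f)) :
    (ofOperator L).IsContinuous := by
  intro f hf F
  simp only [ofOperator_W]
  have h1 : Continuous fun x : E => F x := map_continuous F
  have h2 : Continuous fun c : ℂ => F (L (c • f)) := h1.comp (hL f)
  have h3 : Continuous fun c : ℂ => F (c • f) := h1.comp (by fun_prop)
  exact continuous_const.mul ((Complex.continuous_ofReal.comp h2).mul
    (Complex.continuous_exp.comp (continuous_const.mul (Complex.continuous_ofReal.comp h3))))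

lemma ofOperator_isLinear : (ofOperator L).IsLinear := by
  intro f hf
  have e (F : WeakDual ℝ E) : (ev (WeylPre.W 0 (-f)) * (ofOperator L).toFun ⟨WeylPre.W 0 f, hf⟩) F =
      Complex.I * (F (L f) : ℂ) := by
    rw [ContinuousMap.mul_apply, ofOperator_W, ev_W]
    change Complex.exp (Complex.I * (F (-f) : ℂ)) * _ = _
    rw [map_neg, mul_left_comm, mul_left_comm (Complex.exp _), ← Complex.exp_add]
    simp
  simp only [e]
  refine ⟨fun F G => ?_, fun c F => ?_⟩
  · change Complex.I * ((F (L f) + G (L f) : ℝ) : ℂ) = _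
    push_cast; ring
  · change Complex.I * ((c * F (L f) : ℝ) : ℂ) = _
    rw [Complex.real_smul]; push_cast; ring

/-- The weak derivation of an operator with an everywhere defined adjoint is pointwise closed. -/
lemma ofOperator_isPointwiseClosed (M : E → E) (hM : ∀ k f, (inner ℂ k (L f)).re = (inner ℂ (M k) f).re) :
    (ofOperator L).IsPointwiseClosed := by
  intro u hu f Ψ hw hΨ
  refine ⟨trivial, DFunLike.coe_injective ?_⟩
  -- Both sides are weak-* continuous, so they need only agree on the functionals `Re ⟨k, ·⟩`.
  refine denseRange_innerDual.equalizer Ψ.continuous (ContinuousMap.continuous _) (funext fun k => ?_)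
  refine tendsto_nhds_unique (hΨ (innerDual k)) ?_
  rw [Function.comp_apply, ofOperator_W L f trivial]
  simp only [ofOperator_W]
  -- The operator `L` may be unbounded; weak convergence of `u n` passes through it only after it is
  -- moved onto the fixed vector `k`.
  have h1 : Tendsto (fun n => innerDual k (L (u n))) atTop (𝓝 (innerDual k (L f))) := by
    simp only [innerDual_apply, hM]
    exact hw (innerDual (M k))
  have h2 := (Complex.continuous_ofReal.tendsto _).comp h1
  have h3 := (Complex.continuous_ofReal.tendsto _).comp (hw (innerDual k))
  exact (h2.mul (h3.const_mul Complex.I).cexp).const_mul Complex.I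

end WeakDerivation

end Derivation

open MeasureTheory TestSpace

variable {ν : ℕ}

/-! ### Continuity and closedness of the free derivation -/

lemma inner_hamiltonian (f g : TestSpace ν) :
    inner ℂ f (hamiltonian g) = inner ℂ (hamiltonian f) g := by
  rw [inner_eq_integral_hat, inner_eq_integral_hat]
  refine integral_congr_ae (Eventually.of_forall fun ξ => ?_)
  simp only [hat_hamiltonian, map_mul, Complex.conj_ofReal]; ring

lemma freeDerivation_isContinuous : (freeDerivation ν).IsContinuous := by
  refine WeakDerivation.ofOperator_isContinuous _ fun f => ?_
  have e (c : ℂ) : ((Complex.I • hamiltonian).restrictScalars ℝ : TestSpace ν →ₗ[ℝ] TestSpace ν)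
      (c • f) = c • (Complex.I • hamiltonian f) := by
    rw [LinearMap.coe_restrictScalars, map_smul, LinearMap.smul_apply]
  simp only [e]
  fun_prop

/-- Since `H` is symmetric and maps Schwartz space to itself, `-iH` serves as an everywhere defined
adjoint of `iH`. -/
lemma freeDerivation_isPointwiseClosed : (freeDerivation ν).IsPointwiseClosed := by
  refine WeakDerivation.ofOperator_isPointwiseClosed _ (fun k => -(Complex.I • hamiltonian k))
    fun k f => ?_
  rw [LinearMap.coe_restrictScalars, LinearMap.smul_apply, inner_smul_right, inner_neg_left, inner_smul_left, inner_hamiltonian,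
    Complex.conj_I, neg_mul, neg_neg]

/-! ### The classical states -/

/-- The classical two-point function `(2 β H)⁻¹`. -/
lemma isWeight_classical {β : ℝ} (hβ : 0 < β) :
    IsWeight fun ξ : EuclideanSpace ℝ (Fin ν) => (2 * (β * energy ξ))⁻¹ := by
  refine ⟨?_, fun ξ => ?_, 0, (2 * β)⁻¹, le_rfl, by positivity, fun ξ => ?_⟩
  · have := measurable_energy (ν := ν)
    fun_prop
  · have := energy_nonneg ξ
    positivity
  · rw [zero_add, ← mul_assoc, mul_inv]

/-- The covariance `(β H)⁻¹` with condensate density `c`. -/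
def classicalCovariance (hν : 3 ≤ ν) {β : ℝ} (hβ : 0 < β) (c : ℝ≥0) :
    Covariance (TestSpace ν) 0 :=
  gasCovariance hν 0 (isWeight_classical hβ) (isWeight_classical hβ) (by simp) c

lemma classicalCovariance_gen (hν : 3 ≤ ν) {β : ℝ} (hβ : 0 < β) (c : ℝ≥0) (f : TestSpace ν) :
    (classicalCovariance hν hβ c).gen f =
      (Real.exp (-(1 / 2) * (kineticForm (fun e => (β * e)⁻¹) f + c * ‖total f‖ ^ 2)) : ℂ) := by
  rw [classicalCovariance, gasCovariance_gen (a := 1) (φ := fun e => (β * e)⁻¹)]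
  · congr 2; ring
  · intro ξ
    rw [mul_inv]; ring

lemma weightForm_classical_hamiltonian (hν : 3 ≤ ν) {β : ℝ} (hβ : 0 < β) (f g : TestSpace ν) :
    β * weightForm (fun ξ => (2 * (β * energy ξ))⁻¹) (hamiltonian f) g = inner ℂ f g / 2 := by
  rw [weightForm, inner_eq_integral_hat, ← integral_const_mul, ← integral_div]
  have : Nonempty (Fin ν) := ⟨⟨0, by omega⟩⟩
  have : Nontrivial (EuclideanSpace ℝ (Fin ν)) := inferInstance
  refine integral_congr_ae ?_
  filter_upwards [Measure.ae_ne volume (0 : EuclideanSpace ℝ (Fin ν))] with ξ hξ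
  rw [hat_hamiltonian, map_mul, Complex.conj_ofReal]
  have h1 : (energy ξ : ℂ) ≠ 0 := by exact_mod_cast (energy_pos hξ).ne'
  have h2 : (β : ℂ) ≠ 0 := by exact_mod_cast hβ.ne'
  push_cast
  field_simp

/-- The factor `H` cancels `(2βH)⁻¹`, leaving `(-i/2)(⟨f, g⟩ - ⟨g, f⟩) = σ(f, g)`. The condensate
contributes nothing because `∫ H f = 0`, whence the independence of `c`. This is the hypothesis of
`Covariance.weakKMS`. -/
lemma classicalCovariance_hamiltonian (hν : 3 ≤ ν) {β : ℝ} (hβ : 0 < β) (c : ℝ≥0)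
    (f g : TestSpace ν) :
    β * classicalCovariance hν hβ c
      (((Complex.I • hamiltonian).restrictScalars ℝ : TestSpace ν →ₗ[ℝ] TestSpace ν) f) g =
      symp f g := by
  rw [LinearMap.coe_restrictScalars, LinearMap.smul_apply, classicalCovariance,
    gasCovariance_apply, condensateForm_apply, condensateForm_apply, total_smul, total_hamiltonian,
    IsWeight.weightForm_smul_right, ← conj_weightForm _ g, IsWeight.weightForm_smul_right,
    ← conj_weightForm _ (hamiltonian f)]
  have e := weightForm_classical_hamiltonian hν hβ f g
  have e' := congrArg conj e
  simp only [map_mul, map_div₀, Complex.conj_ofReal, map_ofNat, Complex.conj_I] at e' ⊢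
  have e3 : inner ℂ f g - conj (inner ℂ f g) = 2 * Complex.I * (symp f g : ℂ) := by
    rw [Complex.sub_conj, symp]; push_cast; ring
  simp only [map_zero, mul_zero, zero_mul, add_zero, Complex.conj_conj]
  linear_combination (-Complex.I) * e + Complex.I * e' - (Complex.I / 2) * e3 -
    (symp f g : ℂ) * Complex.I_sq

end FreeBose

end

noncomputable section

namespace FreeBose

open MeasureTheory TestSpace

variable {ν : ℕ}

/-! ### The KMS condition for quasi-free states of the free gas -/

/-- The analytic continuation of the two-point function `t ↦ ⟨f, w e^{itH} g⟩`. -/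
def twoPoint (w : EuclideanSpace ℝ (Fin ν) → ℝ) (f g : TestSpace ν) (z : ℂ) : ℂ :=
  ∫ ξ, Complex.exp (Complex.I * z * energy ξ) * ((w ξ : ℂ) * (conj (hat f ξ) * hat g ξ))

section TwoPoint

variable {w w' : EuclideanSpace ℝ (Fin ν) → ℝ} (f g : TestSpace ν)

lemma weightForm_freeEvolution_right (t : ℝ) :
    weightForm w f (freeEvolution t g) = twoPoint w f g t := by
  refine integral_congr_ae (Eventually.of_forall fun ξ => ?_)
  simp only [hat_freeEvolution]; ring

lemma weightForm_freeEvolution_left (t : ℝ) :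
    weightForm w (freeEvolution t g) f = twoPoint w g f (-t : ℂ) := by
  refine integral_congr_ae (Eventually.of_forall fun ξ => ?_)
  have : conj (Complex.exp (Complex.I * t * energy ξ)) =
      Complex.exp (Complex.I * (-t) * energy ξ) := by
    rw [← Complex.exp_conj]; simp
  simp only [hat_freeEvolution, map_mul, this]; ring

/-- The Boltzmann factor `e^{-bH}` is the evolution through the imaginary time `i b`. -/
lemma twoPoint_of_kms {b : ℝ} (hw : ∀ ξ, w' ξ = w ξ * Real.exp (-(b * energy ξ))) (z : ℂ) :
    twoPoint w' f g z = twoPoint w f g (z + Complex.I * b) := by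
  refine integral_congr_ae (Eventually.of_forall fun ξ => ?_)
  have : Complex.exp (Complex.I * (z + Complex.I * b) * energy ξ) =
      Complex.exp (Complex.I * z * energy ξ) * Complex.exp (-(b * energy ξ)) := by
    rw [← Complex.exp_add]; congr 1
    linear_combination (b * energy ξ : ℂ) * Complex.I_sq
  simp only [hw, this]; push_cast; ring

variable {f g}

lemma continuousOn_twoPoint (h : IsWeight w) (hν : 3 ≤ ν) :
    ContinuousOn (twoPoint w f g) {z | 0 ≤ z.im} :=
  continuousOn_integral_cexp measurable_energy energy_nonneg (h.integrable hν f g)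

/-- Differentiating in `z` produces a factor `energy ξ`, which is absorbed by replacing `g` with the
Schwartz function `H g`. -/
lemma differentiableOn_twoPoint (h : IsWeight w) (hν : 3 ≤ ν) :
    DifferentiableOn ℂ (twoPoint w f g) {z | 0 < z.im} := by
  refine differentiableOn_integral_cexp measurable_energy energy_nonneg (h.integrable hν f g) ?_
  refine (h.integrable hν f (hamiltonian g)).congr (Eventually.of_forall fun ξ => ?_)
  simp only [hat_hamiltonian]; ring

lemma exists_norm_twoPoint_le (h : IsWeight w) (hν : 3 ≤ ν) :
    ∃ C : ℝ, ∀ z : ℂ, 0 ≤ z.im → ‖twoPoint w f g z‖ ≤ C :=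
  ⟨_, fun _ hz => norm_integral_cexp_le measurable_energy energy_nonneg (h.integrable hν f g) hz⟩

end TwoPoint

lemma gasCovariance_gen_freeEvolution (hν : 3 ≤ ν) (h : ℝ≥0)
    {w₁ w₂ : EuclideanSpace ℝ (Fin ν) → ℝ}
    (h₁ : IsWeight w₁) (h₂ : IsWeight w₂) (hw : ∀ ξ, ξ ≠ 0 → w₁ ξ - w₂ ξ = h / 2) (c : ℝ≥0)
    (t : ℝ) (g : TestSpace ν) : (gasCovariance hν h h₁ h₂ hw c).gen (freeEvolution t g) =
      (gasCovariance hν h h₁ h₂ hw c).gen g := by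
  have e (w : EuclideanSpace ℝ (Fin ν) → ℝ) :
      weightForm w (freeEvolution t g) (freeEvolution t g) = weightForm w g g := by
    refine integral_congr_ae (Eventually.of_forall fun ξ => ?_)
    simp only [hat_freeEvolution, map_mul, ← Complex.exp_conj]
    rw [mul_mul_mul_comm, ← Complex.exp_add]
    simp
  simp only [Covariance.gen, gasCovariance_apply, condensateForm_apply, total_freeEvolution, e]

lemma freeDynamics_weyl (h : ℝ≥0) (t : ℝ) (g : TestSpace ν) :
    freeDynamics h t (weyl h g) = weyl h (freeEvolution t g) := secondQuant_weyl _ _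

/-- Quasi-free states whose two-point functions satisfy the detailed balance condition
`w₂ = e^{-bH} w₁` are KMS states of the free evolution. -/
lemma gasCovariance_isKMS (hν : 3 ≤ ν) (h : ℝ≥0) {w₁ w₂ : EuclideanSpace ℝ (Fin ν) → ℝ}
    (h₁ : IsWeight w₁) (h₂ : IsWeight w₂) (hw : ∀ ξ, ξ ≠ 0 → w₁ ξ - w₂ ξ = h / 2) (c : ℝ≥0)
    {b : ℝ} (hb : 0 < b) (hbal : ∀ ξ, w₂ ξ = w₁ ξ * Real.exp (-(b * energy ξ))) :
    (gasCovariance hν h h₁ h₂ hw c).state.IsKMS (freeDynamics h) b := by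
  refine WeylState.isKMS_of_weyl hb fun f g => ?_
  set K := gasCovariance hν h h₁ h₂ hw c with hK
  set c₀ : ℂ := (c / 2 : ℂ) * (condensateForm f g + condensateForm g f) with hc₀
  have hflip : ∀ z : ℂ, (Complex.I * b - z).im = b - z.im := by simp
  obtain ⟨C, hC⟩ := exists_norm_twoPoint_le (f := f) (g := g) h₁ hν
  obtain ⟨C', hC'⟩ := exists_norm_twoPoint_le (f := g) (g := f) h₁ hν
  -- The exponent continues `K(f, e^{itH} g)` analytically. Its second part, `⟨e^{itH} g, w₂ f⟩`,
  -- evolves with `-t` and is rewritten with `w₁` at `i b - t`, so both arguments stay in the closed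
  -- upper half-plane. The condensate term `c₀` does not depend on time.
  refine ⟨fun z => K.gen f * K.gen g *
    Complex.exp (-(twoPoint w₁ f g z + twoPoint w₁ g f (Complex.I * b - z) + c₀)),
    ?_, ?_, ?_, fun t => ⟨?_, ?_⟩⟩
  · refine continuousOn_const.mul (Complex.continuous_exp.comp_continuousOn ?_)
    refine ((ContinuousOn.add ?_ ?_).add continuousOn_const).neg
    · exact (continuousOn_twoPoint h₁ hν).mono fun z hz => hz.1
    · refine (continuousOn_twoPoint h₁ hν).comp (by fun_prop) fun z hz => ?_
      change 0 ≤ (Complex.I * b - z).im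
      rw [hflip]; linarith [hz.2]
  · refine DifferentiableOn.const_mul (DifferentiableOn.cexp ?_) _
    refine ((DifferentiableOn.add ?_ ?_).add (differentiableOn_const _)).neg
    · exact (differentiableOn_twoPoint h₁ hν).mono fun z hz => hz.1
    · refine (differentiableOn_twoPoint h₁ hν).comp (by fun_prop) fun z hz => ?_
      change 0 < (Complex.I * b - z).im
      rw [hflip]; linarith [hz.2]
  · refine ⟨‖K.gen f * K.gen g‖ * Real.exp (C + C' + ‖c₀‖), fun z h0 hzb => ?_⟩
    rw [norm_mul, Complex.norm_exp]
    refine mul_le_mul_of_nonneg_left (Real.exp_le_exp.mpr ?_) (norm_nonneg _)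
    refine (Complex.re_le_norm _).trans ?_
    rw [norm_neg]
    refine (norm_add_le _ _).trans (add_le_add_left ((norm_add_le _ _).trans ?_) _)
    exact add_le_add (hC z h0) (hC' _ (by rw [hflip]; linarith))
  · beta_reduce
    rw [freeDynamics_weyl, weyl_mul_weyl, map_smul, K.state_weyl, smul_eq_mul,
      K.phase_mul_gen, hK, gasCovariance_gen_freeEvolution, gasCovariance_apply,
      condensateForm_apply, condensateForm_apply, total_freeEvolution,
      weightForm_freeEvolution_right, weightForm_freeEvolution_left, twoPoint_of_kms g f hbal,
      hc₀, condensateForm_apply, condensateForm_apply, sub_eq_neg_add]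
  -- At `t + i b` the first two-point function becomes that of `w₂` at `t` and the second that of
  -- `w₁` at `-t`; their sum with `c₀` is `K(e^{itH} g, f)`, the covariance in the opposite order.
  · beta_reduce
    rw [freeDynamics_weyl, weyl_mul_weyl, map_smul, K.state_weyl, smul_eq_mul,
      K.phase_mul_gen, hK, gasCovariance_gen_freeEvolution, gasCovariance_apply,
      condensateForm_apply, condensateForm_apply, total_freeEvolution,
      weightForm_freeEvolution_right, weightForm_freeEvolution_left, twoPoint_of_kms f g hbal,
      hc₀, condensateForm_apply, condensateForm_apply,
      show Complex.I * b - (t + Complex.I * b) = (-t : ℂ) by ring, mul_comm (Covariance.gen _ f),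
      add_comm (twoPoint w₁ f g _), add_comm (conj (total f) * _)]

/-! ### The quantum states -/

section Quantum

variable {β : ℝ} {h : ℝ≥0}

/-- With this `w₁` and `w₂ = e^{-βhH} w₁`, the difference is `h/2` and detailed balance holds by
construction, while the sum is `(h/2) coth (βhH/2)`. -/
lemma isWeight_bose (hβ : 0 < β) (hh : 0 < h) : IsWeight fun ξ : EuclideanSpace ℝ (Fin ν) =>
    h / 2 * (1 - Real.exp (-(β * h * energy ξ)))⁻¹ := by
  have hh' : (0 : ℝ) < h := hh
  refine ⟨?_, fun ξ => ?_, h / 2, h / 2 * (β * h)⁻¹, by positivity, by positivity, fun ξ => ?_⟩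
  · have := measurable_energy (ν := ν)
    fun_prop
  · have := energy_nonneg ξ
    have h1 : Real.exp (-(β * h * energy ξ)) ≤ 1 := Real.exp_le_one_iff.mpr (by
      rw [neg_nonpos]; positivity)
    have : 0 ≤ 1 - Real.exp (-(β * h * energy ξ)) := by linarith
    positivity
  · have := energy_nonneg ξ
    have := inv_one_sub_exp_neg_le (x := β * h * energy ξ) (by positivity)
    calc h / 2 * (1 - Real.exp (-(β * h * energy ξ)))⁻¹ ≤ h / 2 * (1 + (β * h * energy ξ)⁻¹) := by
          gcongr
      _ = _ := by rw [mul_inv]; ring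

lemma isWeight_bose_mul (hβ : 0 < β) (hh : 0 < h) : IsWeight fun ξ : EuclideanSpace ℝ (Fin ν) =>
    h / 2 * (1 - Real.exp (-(β * h * energy ξ)))⁻¹ * Real.exp (-(β * h * energy ξ)) := by
  have hw := isWeight_bose (ν := ν) hβ hh
  refine ⟨hw.measurable.mul ?_, fun ξ => mul_nonneg (hw.nonneg ξ) (Real.exp_pos _).le, ?_⟩
  · have := measurable_energy (ν := ν)
    fun_prop
  · obtain ⟨A, B, hA, hB, hAB⟩ := hw.bound
    refine ⟨A, B, hA, hB, fun ξ => (mul_le_of_le_one_right (hw.nonneg ξ) ?_).trans (hAB ξ)⟩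
    have := energy_nonneg ξ
    exact Real.exp_le_one_iff.mpr (by rw [neg_nonpos]; positivity)

lemma bose_sub (hβ : 0 < β) (hh : 0 < h) {ξ : EuclideanSpace ℝ (Fin ν)} (hξ : ξ ≠ 0) :
    h / 2 * (1 - Real.exp (-(β * h * energy ξ)))⁻¹ -
      h / 2 * (1 - Real.exp (-(β * h * energy ξ)))⁻¹ * Real.exp (-(β * h * energy ξ)) =
      (h : ℝ) / 2 := by
  have h1 := energy_pos hξ
  have hh' : (0 : ℝ) < h := hh
  have := (one_sub_exp_neg_pos (x := β * h * energy ξ) (by positivity)).ne'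
  rw [← mul_one_sub, inv_mul_cancel_right₀ this]

/-- The covariance of the free gas at inverse temperature `β h`, with condensate density `c`. -/
def boseCovariance (hν : 3 ≤ ν) (hβ : 0 < β) (hh : 0 < h) (c : ℝ≥0) :
    Covariance (TestSpace ν) h :=
  gasCovariance hν h (isWeight_bose hβ hh) (isWeight_bose_mul hβ hh) (fun _ => bose_sub hβ hh) c

lemma boseCovariance_isKMS (hν : 3 ≤ ν) (hβ : 0 < β) (hh : 0 < h) (c : ℝ≥0) :
    (boseCovariance hν hβ hh c).state.IsKMS (freeDynamics h) (β * h) :=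
  gasCovariance_isKMS hν h _ _ _ c (mul_pos hβ hh) fun _ => rfl

lemma boseCovariance_gen (hν : 3 ≤ ν) (hβ : 0 < β) (hh : 0 < h) (c : ℝ≥0) (f : TestSpace ν) :
    (boseCovariance hν hβ hh c).gen f =
      (Real.exp (-(h / 2 * kineticForm (fun e => (1 + Real.exp (-(β * h * e))) *
        (1 - Real.exp (-(β * h * e)))⁻¹) f + c * ‖total f‖ ^ 2) / 2) : ℂ) := by
  rw [boseCovariance, gasCovariance_gen (a := h / 2) (φ := fun e =>
    (1 + Real.exp (-(β * h * e))) * (1 - Real.exp (-(β * h * e)))⁻¹)]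
  intro ξ; ring

end Quantum

end FreeBose

end

noncomputable section

namespace FreeBose

open MeasureTheory TestSpace

/-! ### The classical limit -/

section Limit

variable {E : Type*} [NormedAddCommGroup E] [InnerProductSpace ℂ E]

lemma norm_quant_le (h : ℝ≥0) (c : WeylAlg E 0) : ‖quant h c‖ ≤ ‖c‖ := by
  induction c using UniformSpace.Completion.induction_on with
  | hp => exact isClosed_le (by fun_prop) continuous_norm
  | ih a =>
    rw [quant, ContinuousLinearMap.completion_apply_coe, UniformSpace.Completion.norm_coe,
      UniformSpace.Completion.norm_coe]
    exact norm_quantPre_le a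

/-- Convergence of `ω_h ∘ Q_h` may be tested on the Weyl elements. -/
lemma tendsto_quant_of_weyl {ι : Type*} {l : Filter ι} {h : ι → ℝ≥0}
    {ω : (i : ι) → WeylState E (h i)} {ω₀ : WeylState E 0}
    (hW : ∀ f : E, Tendsto (fun i => ω i (quant (h i) (weyl 0 f))) l (𝓝 (ω₀ (weyl 0 f))))
    (c : WeylAlg E 0) : Tendsto (fun i => ω i (quant (h i) c)) l (𝓝 (ω₀ c)) := by
  -- The functionals `ω i ∘ Q` all have Lipschitz constant `1`; for such a family the set of points
  -- of convergence to a continuous limit is closed.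
  have hequi : Equicontinuous fun (i : ι) (c : WeylAlg E 0) => ω i (quant (h i) c) := by
    refine LipschitzWith.uniformEquicontinuous _ 1 (fun i => ?_) |>.equicontinuous
    refine LipschitzWith.of_dist_le_mul fun a b => ?_
    rw [NNReal.coe_one, one_mul, dist_eq_norm, dist_eq_norm, ← map_sub, ← map_sub]
    exact ((ω i).norm_le _).trans (norm_quant_le _ _)
  induction c using UniformSpace.Completion.induction_on with
  | hp => exact hequi.isClosed_setOfPred_tendsto ω₀.continuous
  | ih a =>
    induction a using WeylPre.induction with
    | zero => simpa [UniformSpace.Completion.coe_zero] using tendsto_const_nhds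
    | add x y hx hy => simpa only [UniformSpace.Completion.coe_add, map_add] using hx.add hy
    | W x f =>
      simpa only [UniformSpace.Completion.coe_smul, map_smul, smul_eq_mul, weyl] using
        (hW f).const_mul x

end Limit

/-- The classical limit of the Bose distribution. -/
lemma tendsto_bose {β e : ℝ} (hβ : 0 < β) (he : 0 < e) :
    Tendsto (fun h : ℝ => h / 2 * ((1 + Real.exp (-(β * h * e))) *
      (1 - Real.exp (-(β * h * e)))⁻¹)) (𝓝[>] 0) (𝓝 (β * e)⁻¹) := by
  have hd : HasDerivAt (fun h : ℝ => Real.exp (-(β * h * e))) (-(β * e)) 0 := by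
    have h1 : HasDerivAt (fun h : ℝ => -(β * h * e)) (-(β * e)) 0 := by
      have := (((hasDerivAt_id (0 : ℝ)).const_mul β).mul_const e).neg
      exact this.congr_deriv (by ring)
    exact h1.exp.congr_deriv (by simp)
  -- The quotient `h / (1 - e^{-βhe})` is the inverse of minus the difference quotient of `e^{-βhe}`
  -- at `h = 0`, hence tends to `(βe)⁻¹`.
  have hs : Tendsto (slope (fun h : ℝ => Real.exp (-(β * h * e))) 0) (𝓝[>] 0)
      (𝓝 (-(β * e))) :=
    (hasDerivAt_iff_tendsto_slope.mp hd).mono_left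
      (nhdsWithin_mono _ fun x (hx : 0 < x) => hx.ne')
  have hc : Tendsto (fun h : ℝ => (1 + Real.exp (-(β * h * e))) / 2) (𝓝[>] 0) (𝓝 1) := by
    have h1 : Continuous fun h : ℝ => (1 + Real.exp (-(β * h * e))) / 2 := by fun_prop
    have h2 := (h1.tendsto 0).mono_left (nhdsWithin_le_nhds (s := Set.Ioi 0))
    simpa using h2
  have hne : -(-(β * e)) ≠ 0 := by rw [neg_neg]; positivity
  have := hc.mul (hs.neg.inv₀ hne)
  rw [neg_neg, one_mul] at this
  refine this.congr' ?_
  filter_upwards [self_mem_nhdsWithin] with h (hh : 0 < h)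
  have h1 := (one_sub_exp_neg_pos (x := β * h * e) (by positivity)).ne'
  simp only [slope, vsub_eq_sub, sub_zero, smul_eq_mul, mul_zero, zero_mul, neg_zero,
    Real.exp_zero]
  rw [neg_mul_eq_mul_neg h⁻¹, neg_sub, mul_inv, inv_inv]
  ring

/-- The numerator is at most `2` and the inverse at most `1 + (βhe)⁻¹`; the prefactor `h` removes
the singularity in `h`. This provides the majorant for dominated convergence. -/
lemma bose_le {β e h : ℝ} (hβ : 0 < β) (he : 0 ≤ e) (hh : 0 < h) :
    h / 2 * ((1 + Real.exp (-(β * h * e))) * (1 - Real.exp (-(β * h * e)))⁻¹) ≤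
      h + (β * e)⁻¹ := by
  have h1 : Real.exp (-(β * h * e)) ≤ 1 := Real.exp_le_one_iff.mpr (by
    rw [neg_nonpos]; positivity)
  have h2 := inv_one_sub_exp_neg_le (x := β * h * e) (by positivity)
  have h3 : 0 ≤ (1 - Real.exp (-(β * h * e)))⁻¹ := inv_nonneg.mpr (by linarith)
  calc _ ≤ h / 2 * (2 * (1 + (β * h * e)⁻¹)) := by gcongr; linarith
    _ = h + h * (β * h * e)⁻¹ := by ring
    _ = _ := by
      rw [mul_right_comm, mul_inv (β * e), mul_left_comm, mul_inv_cancel₀ hh.ne', mul_one]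

variable {ν : ℕ}

/-- The classical limit of the kinetic form. -/
lemma tendsto_kineticForm (hν : 3 ≤ ν) {β : ℝ} (hβ : 0 < β) (f : TestSpace ν) :
    Tendsto (fun h : ℝ => h / 2 * kineticForm (fun e => (1 + Real.exp (-(β * h * e))) *
      (1 - Real.exp (-(β * h * e)))⁻¹) f) (𝓝[>] 0) (𝓝 (kineticForm (fun e => (β * e)⁻¹) f)) := by
  have : Nonempty (Fin ν) := ⟨⟨0, by omega⟩⟩
  have : Nontrivial (EuclideanSpace ℝ (Fin ν)) := inferInstance
  simp only [kineticForm, ← integral_const_mul]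
  have hm := measurable_energy (ν := ν)
  have hf : Integrable fun ξ => ‖hat f ξ‖ ^ 2 := ((hat f).memLp 2).norm.integrable_sq
  have hi : Integrable fun ξ => (energy ξ)⁻¹ * ‖hat f ξ‖ ^ 2 := by
    simpa only [Complex.conj_mul', norm_pow, Complex.norm_real, norm_norm] using
      IsWeight.integrable_inv_energy_mul hν f f
  refine tendsto_integral_filter_of_dominated_convergence
    (fun ξ => ‖hat f ξ‖ ^ 2 + β⁻¹ * ((energy ξ)⁻¹ * ‖hat f ξ‖ ^ 2)) ?_ ?_
    (hf.add (hi.const_mul _)) ?_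
  · refine Eventually.of_forall fun h => ?_
    have h1 : Measurable fun ξ : EuclideanSpace ℝ (Fin ν) =>
        (1 + Real.exp (-(β * h * energy ξ))) * (1 - Real.exp (-(β * h * energy ξ)))⁻¹ := by
      fun_prop
    exact (h1.aestronglyMeasurable.mul hf.1).const_mul _
  -- Restricting to `h ≤ 1` makes the majorant `1 + (βe)⁻¹` independent of `h`.
  · filter_upwards [Ioc_mem_nhdsGT one_pos] with h hh
    refine Eventually.of_forall fun ξ => ?_
    have he := energy_nonneg ξ
    have h1 := bose_le hβ he hh.1
    have h0 := hh.1
    have h2 : Real.exp (-(β * h * energy ξ)) ≤ 1 := Real.exp_le_one_iff.mpr (by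
      rw [neg_nonpos]; positivity)
    have h3 : 0 ≤ (1 - Real.exp (-(β * h * energy ξ)))⁻¹ := inv_nonneg.mpr (by linarith)
    rw [Real.norm_of_nonneg (by positivity), ← mul_assoc]
    refine (mul_le_mul_of_nonneg_right (h1.trans (add_le_add_left hh.2 _))
      (sq_nonneg _)).trans_eq ?_
    rw [mul_inv, hat]; ring
  · filter_upwards [Measure.ae_ne volume (0 : EuclideanSpace ℝ (Fin ν))] with ξ hξ
    simp only [← mul_assoc]
    have := (tendsto_bose hβ (energy_pos hξ)).mul_const (‖hat f ξ‖ ^ 2)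
    simpa only [← mul_assoc, hat] using this

lemma tendsto_coe_nhdsGT : Tendsto ((↑) : ℝ≥0 → ℝ) (𝓝[>] 0) (𝓝[>] 0) := by
  refine tendsto_nhdsWithin_iff.mpr ⟨?_, ?_⟩
  · exact (NNReal.continuous_coe.tendsto' 0 0 rfl).mono_left nhdsWithin_le_nhds
  · filter_upwards [self_mem_nhdsWithin] with h (hh : 0 < h)
    exact hh

end FreeBose

end

/-! ### Assembly of the theorem -/

theorem mainTheorem6 (ν : ℕ) (hν : 3 ≤ ν) (β : ℝ) (hβ : 0 < β) :
    ∃ ω₀ : ℝ≥0 → WeylState (TestSpace ν) 0,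
      (∀ (α : ℝ≥0) (f : TestSpace ν), ω₀ α (weyl 0 f) =
        (Real.exp (-(1 / 2) * (kineticForm (fun e => (β * e)⁻¹) f +
          2 ^ ν * α * ‖total f‖ ^ 2)) : ℂ)) ∧
      Function.Injective ω₀ ∧
      (∀ α : ℝ≥0, (ω₀ α).IsWeakKMS (freeDerivation ν) β) ∧
      ∀ (ρ : ℝ≥0 → ℝ) (α : ℝ≥0),
        (∀ h : ℝ≥0, 0 < h → criticalDensity ν (β * h) < ρ h) →
        Tendsto (fun h : ℝ≥0 => h * (ρ h - criticalDensity ν (β * h))) (𝓝[>] 0) (𝓝 (α : ℝ)) →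
        ∃ ω : (h : ℝ≥0) → WeylState (TestSpace ν) h,
          (∀ h : ℝ≥0, 0 < h →
            (∀ f : TestSpace ν, ω h (weyl h f) =
              (Real.exp (-(h / 4) * (kineticForm (fun e => (1 + Real.exp (-(β * h * e))) *
                  (1 - Real.exp (-(β * h * e)))⁻¹) f +
                2 ^ (ν + 1) * (ρ h - criticalDensity ν (β * h)) * ‖total f‖ ^ 2)) : ℂ)) ∧
            (ω h).IsKMS (freeDynamics h) (β * h)) ∧
          ∀ c : WeylAlg (TestSpace ν) 0,
            Tendsto (fun h : ℝ≥0 => ω h (quant h c)) (𝓝[>] 0) (𝓝 (ω₀ α c)) := by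
  have hgen (α : ℝ≥0) (f : TestSpace ν) :
      (classicalCovariance hν hβ (2 ^ ν * α)).state (weyl 0 f) =
        (Real.exp (-(1 / 2) * (kineticForm (fun e => (β * e)⁻¹) f +
          2 ^ ν * α * ‖total f‖ ^ 2)) : ℂ) := by
    rw [Covariance.state_weyl, classicalCovariance_gen]
    push_cast; rfl
  refine ⟨fun α => (classicalCovariance hν hβ (2 ^ ν * α)).state, hgen, fun α α' hα => ?_,
    fun α => ⟨freeDerivation_isContinuous, WeakDerivation.ofOperator_isLinear _,
      freeDerivation_isPointwiseClosed, Covariance.isC2 _, fun a b =>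
        Covariance.weakKMS _ _ β (classicalCovariance_hamiltonian hν hβ _) a b⟩,
    fun ρ α hρ hlim => ?_⟩
  -- A test function with nonzero integral detects `α`: the kinetic terms agree, and the exponential
  -- is injective.
  · obtain ⟨f, hf⟩ := TestSpace.exists_total_ne_zero (ν := ν)
    have h1 := congrArg (fun ω : WeylState (TestSpace ν) 0 => ω (weyl 0 f)) hα
    simp only [hgen] at h1
    have h2 := Real.exp_injective (Complex.ofReal_injective h1)
    have h3 : 0 < ‖total f‖ ^ 2 := by positivity
    have h4 : (2 ^ ν * ‖total f‖ ^ 2) * (α : ℝ) = (2 ^ ν * ‖total f‖ ^ 2) * (α' : ℝ) := by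
      linarith
    exact NNReal.coe_injective (mul_left_cancel₀ (by positivity) h4)
  -- The generating function carries `c/2` in its exponent, so `c = (h/2) 2^(ν+1) (ρ - ρ_c)` matches
  -- the prefactor `h/4`. For `h > 0` the argument is positive and the truncation is harmless.
  · let c (h : ℝ≥0) : ℝ≥0 := Real.toNNReal (h / 2 * (2 ^ (ν + 1) *
      (ρ h - criticalDensity ν (β * h))))
    let ω (h : ℝ≥0) : WeylState (TestSpace ν) h :=
      if hh : 0 < h then (boseCovariance hν hβ hh (c h)).state else PreState.trace.toWeylState
    have hω (h : ℝ≥0) (hh : 0 < h) : ω h = (boseCovariance hν hβ hh (c h)).state := dif_pos hh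
    have hW (h : ℝ≥0) (hh : 0 < h) (f : TestSpace ν) : ω h (weyl h f) =
        (Real.exp (-(h / 4) * (kineticForm (fun e => (1 + Real.exp (-(β * h * e))) *
          (1 - Real.exp (-(β * h * e)))⁻¹) f +
          2 ^ (ν + 1) * (ρ h - criticalDensity ν (β * h)) * ‖total f‖ ^ 2)) : ℂ) := by
      have h0 : 0 < ρ h - criticalDensity ν (β * h) := sub_pos.mpr (hρ h hh)
      rw [hω h hh, Covariance.state_weyl, boseCovariance_gen, Real.coe_toNNReal _ (by positivity)]
      congr 2; ring
    refine ⟨ω, fun h hh => ⟨hW h hh, hω h hh ▸ boseCovariance_isKMS hν hβ hh (c h)⟩,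
      tendsto_quant_of_weyl fun f => ?_⟩
    rw [hgen]
    have hq : Tendsto (fun h : ℝ≥0 => Real.exp (-(h / 4 * ‖f‖ ^ 2))) (𝓝[>] 0) (𝓝 1) := by
      have h1 : Continuous fun h : ℝ≥0 => Real.exp (-(h / 4 * ‖f‖ ^ 2)) := by fun_prop
      have h2 := (h1.tendsto 0).mono_left (nhdsWithin_le_nhds (s := Set.Ioi 0))
      simpa using h2
    have hk := (tendsto_kineticForm hν hβ f).comp tendsto_coe_nhdsGT
    -- Since `(h/4) 2^(ν+1) = (1/2) 2^ν h`, the condensate exponent is governed by `h (ρ - ρ_c)`,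
    -- whose limit is `α`.
    have hs := ((hk.add ((hlim.const_mul (2 ^ ν)).mul_const (‖total f‖ ^ 2))).const_mul
      (-(1 / 2))).rexp
    have hp := (Complex.continuous_ofReal.tendsto _).comp (hq.mul hs)
    rw [one_mul] at hp
    refine hp.congr' ?_
    filter_upwards [self_mem_nhdsWithin] with h (hh : 0 < h)
    rw [quant_weyl, map_smul, smul_eq_mul, hW h hh, ← Complex.ofReal_mul]
    simp only [Function.comp_apply]
    congr 3; ring
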